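/- Let $G$ be a (discrete) group. Identify $\ell^1(G)^{*}$ with $\ell^\infty(G)$ (complex-valued bounded functions) and $\ell^1(G)^{**}$ with the space of bounded linear functionals on $\ell^\infty(G)$, equipped with the first Arens product $$\langle \Psi\,\Box\,\Phi,\lambda\rangle=\langle \Psi,\Phi\cdot\lambda\rangle,\qquad (\Phi\cdot\lambda)(s)=\langle \Phi,\ t\mapsto\lambda(st)\rangle\qquad(\lambda\in\ell^\infty(G),\ s\in G).$$ For $H\le G$, regard $\ell^1(H)^{**}$ as a subspace of $\ell^1(G)^{**}$ via the second conjugate of the inclusion $\ell^1(H)\hookrightarrow\ell^1(G)$. An invariant difference on a group $H$ is an element $\Gamma\in\ell^1(H)^{**}$ with $\delta_s\,\Box\,\Gamma=\Gamma$ for all $s\in H$ and $\langle\Gamma,1\rangle=0$. Let $\mathcal A_{sn}(G)$ be the (not necessarily unital) subalgebra of $\ell^1(G)^{**}$ generated by all invariant differences on subnormal subgroups of $G$. An algebra $A$ is nilpotent of index $m\ge 1$ if $m$ is the least positive integer with $A^m=\{0\}$, where $A^m$ is the linear span of all products of $m$ elements of $A$. An infinite group is just infinite if each of its non-trivial normal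 subgroups has finite index, and a just infinite group is hereditarily just infinite if each of its non-trivial normal subgroups is just infinite. The Baer radical of a group is the subgroup generated by its subnormal cyclic subgroups. The structure lattice of $G$ is the set of subnormal subgroups of $G$ modulo commensurability, where $H,K$ are commensurable if $[H:H\cap K]<\infty$ and $[K:H\cap K]<\infty$. **Proposition.** Let $G$ be an amenable just infinite group with trivial Baer radical and finite structure lattice. Then $G$ has a finite-index normal subgroup which is an internal direct product $H_1\times\cdots\times H_n$ of mutually isomorphic subgroups $H_i$ that are hereditarily just infinite with trivial Baer radical and are permuted transitively by $G$ acting by conjugation. Moreover, for every such decomposition of a finite-index normal subgroup of $G$, with $n$ factors, $\mathcal A_{sn}(G)$ is nilpotent of index exactly $n+1$. -/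

import Mathlib

open scoped ENNReal

noncomputable section

/-! ## The bidual of `ℓ¹(G)` and the first Arens product -/

/-- `ℓ^∞(X)`: the Banach space (algebra) of bounded complex functions on a set `X`. -/
abbrev LInfty (X : Type*) : Type _ := lp (fun _ : X => ℂ) ∞

/-- Composition with a map `f : X → Y`, as a bounded operator `ℓ^∞(Y) → ℓ^∞(X)`,
`l ↦ l ∘ f`. -/
def LInfty.pullback {X Y : Type*} (f : X → Y) : LInfty Y →L[ℂ] LInfty X :=
  LinearMap.mkContinuous
    { toFun := fun l =>
        ⟨fun x => l (f x), memℓp_infty ⟨‖l‖, by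
          rintro _ ⟨x, rfl⟩
          exact lp.norm_apply_le_norm ENNReal.top_ne_zero l (f x)⟩⟩
      map_add' := fun _ _ => rfl
      map_smul' := fun _ _ => rfl }
    1 (fun l => by
      rw [one_mul]
      exact lp.norm_le_of_forall_le (norm_nonneg l) fun x =>
        lp.norm_apply_le_norm ENNReal.top_ne_zero l (f x))

@[simp]
theorem LInfty.pullback_apply {X Y : Type*} (f : X → Y) (l : LInfty Y) (x : X) :
    LInfty.pullback f l x = l (f x) := rfl

/-- The bidual `ℓ¹(X)**`, under the usual identification `ℓ¹(X)* = ℓ^∞(X)`: the bounded linear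
functionals on `ℓ^∞(X)`. The pairing `⟨Φ, l⟩` is application `Φ l`. -/
abbrev L1Bidual (X : Type*) : Type _ := StrongDual ℂ (LInfty X)

namespace L1Bidual

/-- The second conjugate `f** : ℓ¹(X)** → ℓ¹(Y)**` of the map `ℓ¹(X) → ℓ¹(Y)`, `δ_x ↦ δ_{f x}`,
induced by `f : X → Y`. -/
def push {X Y : Type*} (f : X → Y) : L1Bidual X →ₗ[ℂ] L1Bidual Y where
  toFun Φ := Φ.comp (LInfty.pullback f)
  map_add' _ _ := rfl
  map_smul' _ _ := rfl

/-- The point mass `δ_x`, as an element of `ℓ¹(X)**`: `⟨δ_x, l⟩ = l x`. -/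
def pointMass {X : Type*} (x : X) : L1Bidual X :=
  LinearMap.mkContinuous
    { toFun := fun l => l x
      map_add' := fun _ _ => rfl
      map_smul' := fun _ _ => rfl }
    1 (fun l => by
      rw [one_mul]
      exact lp.norm_apply_le_norm ENNReal.top_ne_zero l x)

variable {G : Type*} [Group G]

/-- The module action `Φ · l` of `Φ ∈ ℓ¹(G)**` on `l ∈ ℓ^∞(G) = ℓ¹(G)*` used to define the first
Arens product: `⟨a, Φ · l⟩ = ⟨Φ, l · a⟩`, where `⟨b, l · a⟩ = ⟨a * b, l⟩`. On point masses,
`(l · δ_s)(t) = l (s * t)`, and so `(Φ · l)(s) = ⟨Φ, t ↦ l (s * t)⟩`. -/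
def act (Φ : L1Bidual G) : LInfty G →L[ℂ] LInfty G :=
  have key : ∀ (l : LInfty G) (s : G),
      ‖Φ (LInfty.pullback (fun t => s * t) l)‖ ≤ ‖Φ‖ * ‖l‖ := fun l s =>
    (Φ.le_opNorm _).trans (mul_le_mul_of_nonneg_left
      (lp.norm_le_of_forall_le (norm_nonneg l) fun t =>
        lp.norm_apply_le_norm ENNReal.top_ne_zero l (s * t)) (norm_nonneg Φ))
  LinearMap.mkContinuous
    { toFun := fun l =>
        ⟨fun s => Φ (LInfty.pullback (fun t => s * t) l), memℓp_infty ⟨‖Φ‖ * ‖l‖, by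
          rintro _ ⟨s, rfl⟩
          exact key l s⟩⟩
      map_add' := fun l m => by
        ext s
        exact (congrArg Φ (map_add (LInfty.pullback (fun t => s * t)) l m)).trans (map_add Φ _ _)
      map_smul' := fun c l => by
        ext s
        exact (congrArg Φ (map_smul (LInfty.pullback (fun t => s * t)) c l)).trans
          (map_smul Φ c _) }
    ‖Φ‖ (fun l => lp.norm_le_of_forall_le (mul_nonneg (norm_nonneg _) (norm_nonneg _)) (key l))

@[simp]
theorem act_apply (Φ : L1Bidual G) (l : LInfty G) (s : G) :
    act Φ l s = Φ (LInfty.pullback (fun t => s * t) l) := rfl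

/-- The first Arens product: `⟨Ψ □ Φ, l⟩ = ⟨Ψ, Φ · l⟩`. -/
instance instMul : Mul (L1Bidual G) := ⟨fun Ψ Φ => Ψ.comp (act Φ)⟩

@[simp]
theorem mul_apply (Ψ Φ : L1Bidual G) (l : LInfty G) : (Ψ * Φ) l = Ψ (act Φ l) := rfl

/-- `ℓ¹(G)**` is a ring for the first Arens product. -/
instance instNonUnitalRing : NonUnitalRing (L1Bidual G) :=
  { (inferInstance : AddCommGroup (L1Bidual G)), (instMul : Mul (L1Bidual G)) with
    left_distrib := fun Ψ Φ₁ Φ₂ => by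
      ext l
      exact (congrArg Ψ (show act (Φ₁ + Φ₂) l = act Φ₁ l + act Φ₂ l from rfl)).trans
        (map_add Ψ _ _)
    right_distrib := fun _ _ _ => rfl
    zero_mul := fun _ => rfl
    mul_zero := fun Ψ => by
      ext l
      exact (congrArg Ψ (show act (0 : L1Bidual G) l = 0 from rfl)).trans (map_zero Ψ)
    mul_assoc := fun Θ Ψ Φ => by
      ext l
      refine congrArg Θ ?_
      ext s
      refine congrArg Ψ ?_
      ext t
      refine congrArg Φ ?_
      ext u
      exact congrArg (fun x => l x) (mul_assoc s t u) }

instance instIsScalarTower : IsScalarTower ℂ (L1Bidual G) (L1Bidual G) :=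
  ⟨fun _ _ _ => rfl⟩

instance instSMulCommClass : SMulCommClass ℂ (L1Bidual G) (L1Bidual G) :=
  ⟨fun c Ψ Φ => by
    ext l
    exact ((congrArg Ψ (show act (c • Φ) l = c • act Φ l from rfl)).trans
      (map_smul Ψ c _)).symm⟩

/-- `Φ` is left-invariant: `δ_s □ Φ = Φ` for all `s ∈ G`. -/
def IsLeftInvariant (Φ : L1Bidual G) : Prop := ∀ s : G, pointMass s * Φ = Φ

/-- `Γ` is an invariant difference on `G`: it is left-invariant and `⟨Γ, 1⟩ = 0`. -/
def IsInvariantDifference (Γ : L1Bidual G) : Prop := IsLeftInvariant Γ ∧ Γ 1 = 0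

/-- `M` is a left-invariant mean on `G`: a left-invariant functional on `ℓ^∞(G)` with
`‖M‖ = ⟨M, 1⟩ = 1`. -/
def IsInvariantMean (M : L1Bidual G) : Prop := IsLeftInvariant M ∧ ‖M‖ = 1 ∧ M 1 = 1

end L1Bidual

/-- A (discrete) group is amenable if it has a left-invariant mean. -/
def IsAmenableGroup (G : Type*) [Group G] : Prop :=
  ∃ M : L1Bidual G, L1Bidual.IsInvariantMean M

/-- The algebra `A_sn(G)`: the (not necessarily unital) subalgebra of `ℓ¹(G)**` generated by the
invariant differences on the subnormal subgroups `H` of `G`, where `ℓ¹(H)**` is viewed inside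
`ℓ¹(G)**` through the second conjugate of the inclusion. -/
def Asn (G : Type*) [Group G] : NonUnitalSubalgebra ℂ (L1Bidual G) :=
  NonUnitalAlgebra.adjoin ℂ
    {Φ | ∃ H : Subgroup G, H.IsSubnormal ∧
      ∃ Γ : L1Bidual H, L1Bidual.IsInvariantDifference Γ ∧
        L1Bidual.push (fun h : H => (h : G)) Γ = Φ}

/-! ## Nilpotent algebras -/

section Nilpotent

variable {A : Type*} [NonUnitalRing A] [Module ℂ A] [IsScalarTower ℂ A A] [SMulCommClass ℂ A A]

/-- The power `S ^ (k + 1)` of an algebra `S ⊆ A`: the linear span of the products of `k + 1`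
elements of `S`. -/
def algebraPowSucc (S : NonUnitalSubalgebra ℂ A) : ℕ → Submodule ℂ A
  | 0 => S.toSubmodule
  | k + 1 => Submodule.span ℂ {z | ∃ x ∈ S, ∃ y ∈ algebraPowSucc S k, z = x * y}

/-- `S` is nilpotent of index `m`: `m` is the least natural number `m ≥ 1` with `S ^ m = 0`. -/
def IsNilpotentOfIndex (S : NonUnitalSubalgebra ℂ A) (m : ℕ) : Prop :=
  IsLeast {m : ℕ | ∃ k : ℕ, m = k + 1 ∧ algebraPowSucc S k = ⊥} m

end Nilpotent

/-! ## Just infinite groups -/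

/-- A group is just infinite if it is infinite and every non-trivial normal subgroup has finite
index. -/
def IsJustInfinite (G : Type*) [Group G] : Prop :=
  Infinite G ∧ ∀ N : Subgroup G, N.Normal → N ≠ ⊥ → N.FiniteIndex

/-- A group is hereditarily just infinite if it is just infinite and so is every non-trivial normal
subgroup. -/
def IsHereditarilyJustInfinite (G : Type*) [Group G] : Prop :=
  IsJustInfinite G ∧ ∀ N : Subgroup G, N.Normal → N ≠ ⊥ → IsJustInfinite N

/-- The Baer radical: the subgroup generated by the subnormal cyclic subgroups. -/
def baerRadical (G : Type*) [Group G] : Subgroup G :=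
  sSup {C : Subgroup G | C.IsSubnormal ∧ IsCyclic C}

/-- Commensurability on the set of subnormal subgroups of `G`. -/
def subnormalCommensurable (G : Type*) [Group G] : Setoid {H : Subgroup G // H.IsSubnormal} where
  r H K := Subgroup.Commensurable (H : Subgroup G) (K : Subgroup G)
  iseqv := ⟨fun H => Subgroup.Commensurable.refl (H : Subgroup G), fun h => h.symm,
    fun h₁ h₂ => h₁.trans h₂⟩

/-- The underlying set of the structure lattice of `G`: subnormal subgroups of `G` modulo
commensurability. -/
def StructureLattice (G : Type*) [Group G] : Type _ := Quotient (subnormalCommensurable G)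

/-- The subgroups `H₁, …, Hₙ` of `G` generate their internal direct product, which is a normal
subgroup of finite index in `G`; they are mutually isomorphic, hereditarily just infinite, and have
trivial Baer radical; and `G` permutes them transitively by conjugation. -/
structure IsHJIDecomposition {G : Type*} [Group G] {n : ℕ} (H : Fin n → Subgroup G) : Prop where
  commute : ∀ i j, i ≠ j → ∀ x ∈ H i, ∀ y ∈ H j, x * y = y * x
  independent : iSupIndep H
  normal : (⨆ i, H i).Normal
  finiteIndex : (⨆ i, H i).FiniteIndex
  isomorphic : ∀ i j, Nonempty (H i ≃* H j)
  hereditarilyJustInfinite : ∀ i, IsHereditarilyJustInfinite (H i)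
  trivialBaerRadical : ∀ i, baerRadical (H i) = ⊥
  conj_mem : ∀ (g : G) (i), ∃ j, (H i).map (MulAut.conj g).toMonoidHom = H j
  transitive : ∀ i j, ∃ g : G, (H i).map (MulAut.conj g).toMonoidHom = H j

end

/-! Existence of the decomposition. Call `B` basal if it is non-trivial, normal in a finite-index
normal subgroup, and meets its other conjugates trivially. The conjugates of a basal subgroup form a
direct product of finite index, and they are pairwise incommensurable subnormal subgroups, so their
number is bounded by the size of the structure lattice (`IsBasal.card_le`). Take `B` with as many
conjugates as possible. A non-trivial normal subgroup of `B` contains a basal `C`, which by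
maximality has exactly one conjugate inside each conjugate of `B`; hence `C` has finite index in
`B`. This makes `B` hereditarily just infinite, and its conjugates are the factors.

Upper bound. Let `V k` (`invariantSpan`) be spanned by the functionals whose stabilizer has finite
index in at least `k` of the factors. Left multiplication by an invariant difference on a subnormal
subgroup maps `V k` into `V (k + 1)` (`mul_mem_invariantSpan_of_relIndex`): either the product
vanishes, or invariance along one more factor is gained. Since `V 0` is everything and `V (n + 1) =
0`, all products of `n + 1` elements vanish.

Lower bound. By amenability every factor carries a non-zero invariant difference, obtained from two
invariant functionals concentrated on disjoint thick sets. Functionals on independent subgroups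
multiply like a tensor product, so the product over all `n` factors is non-zero. -/

noncomputable section

/-! ## Commuting subgroups -/

namespace Subgroup

variable {G : Type*} [Group G]

/-- Every element of `A` commutes with every element of `B`. -/
def CommutesWith (A B : Subgroup G) : Prop := ∀ a ∈ A, ∀ b ∈ B, a * b = b * a

theorem CommutesWith.symm {A B : Subgroup G} (h : A.CommutesWith B) : B.CommutesWith A :=
  fun b hb a ha => (h a ha b hb).symm

theorem CommutesWith.mono {A B A' B' : Subgroup G} (h : A.CommutesWith B) (hA : A' ≤ A)
    (hB : B' ≤ B) : A'.CommutesWith B' :=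
  fun a ha b hb => h a (hA ha) b (hB hb)

theorem commutesWith_iff_le_centralizer {A B : Subgroup G} :
    A.CommutesWith B ↔ B ≤ centralizer (A : Set G) := by
  simp only [CommutesWith, SetLike.le_def, mem_centralizer_iff, SetLike.mem_coe]
  exact ⟨fun h b hb a ha => h a ha b hb, fun h a ha b hb => h hb a ha⟩

theorem CommutesWith.iSup_right {ι : Sort*} {A : Subgroup G} {B : ι → Subgroup G}
    (h : ∀ i, A.CommutesWith (B i)) : A.CommutesWith (⨆ i, B i) := by
  simp only [commutesWith_iff_le_centralizer] at h ⊢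
  exact iSup_le h

theorem CommutesWith.sup_right {A B C : Subgroup G} (h : A.CommutesWith B)
    (h' : A.CommutesWith C) : A.CommutesWith (B ⊔ C) := by
  simp only [commutesWith_iff_le_centralizer] at h h' ⊢
  exact sup_le h h'

theorem CommutesWith.le_normalizer {A B : Subgroup G} (h : A.CommutesWith B) :
    B ≤ normalizer A := by
  intro b hb
  rw [mem_normalizer_iff]
  intro x
  constructor
  · intro hx
    rwa [← h x hx b hb, mul_inv_cancel_right]
  · intro hx
    have h1 := h _ hx b hb
    have h2 : x = b * x * b⁻¹ := by
      have : b * x * b⁻¹ * b = b * x := by group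
      rw [this] at h1
      exact mul_left_cancel h1
    rw [h2]
    exact hx

theorem CommutesWith.exists_mul_of_mem_sup {A B : Subgroup G} (h : A.CommutesWith B) {x : G}
    (hx : x ∈ A ⊔ B) : ∃ a ∈ A, ∃ b ∈ B, a * b = x := by
  rw [← SetLike.mem_coe, coe_mul_of_right_le_normalizer_left A B h.le_normalizer] at hx
  exact Set.mem_mul.1 hx

/-- If a subgroup has finite relative index in two commuting subgroups, it has finite relative
index in their product. -/
theorem CommutesWith.relIndex_sup_ne_zero {A B T : Subgroup G} (h : A.CommutesWith B)
    (hA : T.relIndex A ≠ 0) (hB : T.relIndex B ≠ 0) : T.relIndex (A ⊔ B) ≠ 0 := by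
  -- Cosets of `Y` in `X` surject onto cosets of `Y ⊔ Z` in `X ⊔ Z`, because the `Z`-part of an
  -- element is absorbed.
  have key : ∀ {X Y Z : Subgroup G}, X.CommutesWith Z → Y ≤ X → Y.relIndex X ≠ 0 →
      (Y ⊔ Z).relIndex (X ⊔ Z) ≠ 0 := by
    intro X Y Z hXZ hYX hY
    have : Finite (X ⧸ Y.subgroupOf X) := index_ne_zero_iff_finite.1 hY
    let f : X ⧸ Y.subgroupOf X → ↥(X ⊔ Z) ⧸ (Y ⊔ Z).subgroupOf (X ⊔ Z) :=
      Quotient.map' (fun x => ⟨x, le_sup_left (a := X) x.2⟩) (by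
        intro a b hab
        rw [QuotientGroup.leftRel_apply, mem_subgroupOf] at hab ⊢
        exact le_sup_left (a := Y) hab)
    have hf : Function.Surjective f := by
      intro q
      induction q using QuotientGroup.induction_on with
      | H z =>
        obtain ⟨x, hx, w, hw, hxw⟩ := hXZ.exists_mul_of_mem_sup z.2
        refine ⟨QuotientGroup.mk ⟨x, hx⟩, ?_⟩
        refine QuotientGroup.eq.2 ?_
        rw [mem_subgroupOf]
        have : x⁻¹ * (z : G) = w := by rw [← hxw]; group
        exact le_sup_right (a := Y) (by simpa [this] using hw)
    exact index_ne_zero_iff_finite.2 (Finite.of_surjective f hf)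
  have hA' : (T ⊓ A).relIndex A ≠ 0 := by rwa [inf_relIndex_right]
  have hB' : (T ⊓ B).relIndex B ≠ 0 := by rwa [inf_relIndex_right]
  -- Replace one factor at a time: `(T ⊓ A)(T ⊓ B) ≤ (T ⊓ A) B ≤ A B`.
  have h1 := key h inf_le_right hA'
  have h2 : (T ⊓ B ⊔ T ⊓ A).relIndex (B ⊔ T ⊓ A) ≠ 0 :=
    key (h.symm.mono le_rfl inf_le_right) inf_le_right hB'
  rw [sup_comm B] at h2
  exact fun h0 => relIndex_ne_zero_trans h2 h1
    (relIndex_eq_zero_of_le_left (sup_le inf_le_left inf_le_left) h0)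

theorem relIndex_biSup_ne_zero {ι : Type*} {H : ι → Subgroup G}
    (hc : ∀ i j, i ≠ j → (H i).CommutesWith (H j)) {T : Subgroup G} (s : Finset ι)
    (h : ∀ i ∈ s, T.relIndex (H i) ≠ 0) : T.relIndex (⨆ i ∈ s, H i) ≠ 0 := by
  classical
  induction s using Finset.induction_on with
  | empty => simp
  | insert a s ha ih =>
    rw [Finset.iSup_insert]
    refine CommutesWith.relIndex_sup_ne_zero ?_ (h a (Finset.mem_insert_self a s))
      (ih fun i hi => h i (Finset.mem_insert_of_mem hi))
    refine CommutesWith.iSup_right fun i => CommutesWith.iSup_right fun hi => hc a i ?_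
    rintro rfl
    exact ha hi

theorem relIndex_iSup_ne_zero {ι : Type*} [Finite ι] {H : ι → Subgroup G}
    (hc : ∀ i j, i ≠ j → (H i).CommutesWith (H j)) {T : Subgroup G}
    (h : ∀ i, T.relIndex (H i) ≠ 0) : T.relIndex (⨆ i, H i) ≠ 0 := by
  have := Fintype.ofFinite ι
  simpa using relIndex_biSup_ne_zero hc Finset.univ fun i _ => h i

/-- The commutator of `a` and `b` lies in both `A` and `B`. -/
theorem commutesWith_of_le_normalizer {A B : Subgroup G} (hA : B ≤ normalizer A)
    (hB : A ≤ normalizer B) (h : Disjoint A B) : A.CommutesWith B := by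
  intro a ha b hb
  have h1 : a * b * a⁻¹ * b⁻¹ ∈ A := by
    have := mul_mem ha ((mem_normalizer_iff.1 (hA hb) a⁻¹).1 (inv_mem ha))
    simpa [mul_assoc] using this
  have h2 : a * b * a⁻¹ * b⁻¹ ∈ B :=
    mul_mem ((mem_normalizer_iff.1 (hB ha) b).1 hb) (inv_mem hb)
  have h3 := disjoint_def.1 h h1 h2
  have : a * b * a⁻¹ * b⁻¹ * b * a = b * a := by rw [h3]; group
  rw [← this]; group

/-- In an independent commuting family, the intersection of the products of all factors but the
`i`-th, for `i ∈ s`, is contained in the product of the factors outside `s`. -/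
theorem iInf_iSup_ne_le {ι : Type*} {H : ι → Subgroup G}
    (hc : ∀ i j, i ≠ j → (H i).CommutesWith (H j)) (hi : iSupIndep H) (s : Finset ι) {x : G}
    (hx : x ∈ ⨆ i, H i) (hs : ∀ i ∈ s, x ∈ ⨆ (j) (_ : j ≠ i), H j) :
    x ∈ ⨆ (j) (_ : j ∉ s), H j := by
  classical
  induction s using Finset.induction_on with
  | empty => simpa using hx
  | insert a s ha ih =>
    have h1 := ih fun i hi => hs i (Finset.mem_insert_of_mem hi)
    have h2 : (⨆ (j) (_ : j ∉ s), H j) ≤ H a ⊔ ⨆ (j) (_ : j ∉ insert a s), H j := by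
      refine iSup₂_le fun j hj => ?_
      by_cases hja : j = a
      · subst hja; exact le_sup_left
      · exact le_sup_of_le_right (le_iSup₂_of_le j (by simp [hja, hj]) le_rfl)
    have h3 : (⨆ (j) (_ : j ∉ insert a s), H j) ≤ ⨆ (j) (_ : j ≠ a), H j :=
      iSup₂_le fun j hj => le_iSup₂_of_le j (by rintro rfl; simp at hj) le_rfl
    have hcomm : (H a).CommutesWith (⨆ (j) (_ : j ∉ insert a s), H j) :=
      CommutesWith.iSup_right fun j => CommutesWith.iSup_right fun hj =>
        hc a j (by rintro rfl; simp at hj)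
    obtain ⟨y, hy, z, hz, rfl⟩ := hcomm.exists_mul_of_mem_sup (h2 h1)
    have h4 : y ∈ ⨆ (j) (_ : j ≠ a), H j := by
      have := mul_mem (hs a (Finset.mem_insert_self a s)) (inv_mem (h3 hz))
      simpa using this
    have h5 : y = 1 := disjoint_def.1 (hi a) hy h4
    simpa [h5] using hz

theorem IsSubnormal.of_le_normalizer {B K : Subgroup G} (hB : B ≤ K) (hK : K.IsSubnormal)
    (h : K ≤ normalizer B) : B.IsSubnormal :=
  IsSubnormal.step B K hB hK (normal_subgroupOf_of_le_normalizer h)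

theorem infinite_of_relIndex_ne_zero {A B : Subgroup G} [Infinite B] (h : A.relIndex B ≠ 0) :
    Infinite A := by
  by_contra hA
  have : Finite A := not_infinite_iff_finite.1 hA
  have h1 : (⊥ : Subgroup G).relIndex A ≠ 0 := by
    rw [relIndex_bot_left]; exact Nat.card_pos.ne'
  have h2 := relIndex_ne_zero_trans h1 h
  rw [relIndex_bot_left] at h2
  exact h2 Nat.card_eq_zero_of_infinite

theorem infinite_of_index_ne_zero {A : Subgroup G} [Infinite G] (h : A.index ≠ 0) :
    Infinite A := by
  have : Infinite (⊤ : Subgroup G) := Infinite.of_injective (fun g : G => ⟨g, mem_top g⟩)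
    fun a b hab => by simpa using hab
  exact infinite_of_relIndex_ne_zero (B := ⊤) (by rwa [relIndex_top_right])

theorem ne_bot_of_infinite {A : Subgroup G} [hA : Infinite A] : A ≠ ⊥ := by
  rintro rfl
  exact not_finite (⊥ : Subgroup G)

end Subgroup

open Subgroup

/-! ## Just infinite groups with trivial Baer radical -/

section JustInfinite

variable {G : Type*} [Group G]

/-- A cyclic subgroup of an abelian normal subgroup is subnormal, so it lies in the Baer radical. -/
theorem eq_one_of_mem_commutative_normal (hb : baerRadical G = ⊥) {Z : Subgroup G} (hZ : Z.Normal)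
    (hcomm : Z.CommutesWith Z) {z : G} (hz : z ∈ Z) : z = 1 := by
  have hle : zpowers z ≤ Z := (zpowers_le).2 hz
  have hsub : (zpowers z).IsSubnormal :=
    IsSubnormal.of_le_normalizer hle hZ.isSubnormal (hcomm.mono hle le_rfl).le_normalizer
  have : zpowers z ≤ baerRadical G := le_sSup ⟨hsub, inferInstance⟩
  rw [hb] at this
  simpa using this (mem_zpowers z)

/-- In a just infinite group with trivial Baer radical, subgroups of finite index have trivial
centralizer. -/
theorem eq_one_of_commute_finiteIndex (hji : IsJustInfinite G) (hb : baerRadical G = ⊥)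
    {F : Subgroup G} (hF : F.index ≠ 0) {x : G} (hx : ∀ f ∈ F, x * f = f * x) : x = 1 := by
  by_contra hne
  have := hji.1
  have : F.FiniteIndex := ⟨hF⟩
  -- If the centralizer of the core `N` is non-trivial, it has finite index, and its intersection
  -- with `N` is an infinite abelian normal subgroup.
  set N := F.normalCore
  have hN : N.index ≠ 0 := FiniteIndex.index_ne_zero
  have hxC : x ∈ centralizer (N : Set G) :=
    mem_centralizer_iff.2 fun f hf => (hx f (normalCore_le F hf)).symm
  have hCne : centralizer (N : Set G) ≠ ⊥ := by
    intro h
    rw [h] at hxC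
    exact hne (by simpa using hxC)
  have hCi := (hji.2 _ inferInstance hCne).index_ne_zero
  have hZi : (N ⊓ centralizer (N : Set G)).index ≠ 0 := index_inf_ne_zero hN hCi
  have := infinite_of_index_ne_zero hZi
  refine ne_bot_of_infinite (A := N ⊓ centralizer (N : Set G)) ((eq_bot_iff_forall _).2 ?_)
  intro z hz
  refine eq_one_of_mem_commutative_normal hb (Z := N ⊓ centralizer (N : Set G)) inferInstance ?_ hz
  intro a ha b hb
  exact mem_centralizer_iff.1 hb.2 a ha.1

/-- Non-trivial subnormal subgroups of a hereditarily just infinite group with trivial Baer radical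
have finite index. -/
theorem IsHereditarilyJustInfinite.eq_bot_or_index_ne_zero (hG : IsHereditarilyJustInfinite G)
    (hb : baerRadical G = ⊥) {D : Subgroup G} (hD : D.IsSubnormal) : D = ⊥ ∨ D.index ≠ 0 := by
  have := hG.1.1
  induction hD with
  | top => right; simp
  | step D L hDL hL hN ih =>
    by_cases hbot : D = ⊥
    · exact Or.inl hbot
    right
    have hLbot : L ≠ ⊥ := fun h => hbot (le_bot_iff.1 (h ▸ hDL))
    have hLi := ih.resolve_left hLbot
    have : L.FiniteIndex := ⟨hLi⟩
    -- `N` is normal in the whole group, hence just infinite, and it normalizes `D`. If `D ⊓ N` is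
    -- trivial then `D` centralizes `N`, forcing `D = ⊥`; otherwise `D ⊓ N` has finite index in `N`.
    set N := L.normalCore
    have hNi : N.index ≠ 0 := FiniteIndex.index_ne_zero
    have := infinite_of_index_ne_zero hNi
    have hNJ := hG.2 N inferInstance ne_bot_of_infinite
    have hLD : L ≤ normalizer D := (normal_subgroupOf_iff_le_normalizer hDL).1 hN
    by_cases hDN : Disjoint D N
    · exfalso
      have hc : D.CommutesWith N := commutesWith_of_le_normalizer
        ((normalCore_le L).trans hLD) le_normalizer_of_normal hDN
      refine hbot ((eq_bot_iff_forall _).2 fun x hx => ?_)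
      exact eq_one_of_commute_finiteIndex hG.1 hb hNi fun f hf => hc x hx f hf
    · have hn : (D.subgroupOf N).Normal :=
        normal_subgroupOf_of_le_normalizer ((normalCore_le L).trans hLD)
      have h1 : D.subgroupOf N ≠ ⊥ := by
        rwa [Ne, subgroupOf_eq_bot]
      have h2 : D.relIndex N ≠ 0 := (hNJ.2 _ hn h1).index_ne_zero
      have h3 : N.relIndex ⊤ ≠ 0 := by rwa [relIndex_top_right]
      have := relIndex_ne_zero_trans h2 h3
      rwa [relIndex_top_right] at this

end JustInfinite

end

noncomputable section

open Subgroup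

/-! ## Basal subgroups -/

section Conjugates

variable {G : Type*} [Group G]

/-- The conjugate `g B g⁻¹`. -/
abbrev conjSubgroup (g : G) (B : Subgroup G) : Subgroup G := B.map (MulAut.conj g).toMonoidHom

theorem mem_conjSubgroup {g x : G} {B : Subgroup G} :
    x ∈ conjSubgroup g B ↔ g⁻¹ * x * g ∈ B := by
  constructor
  · rintro ⟨y, hy, rfl⟩
    simpa [mul_assoc] using hy
  · intro h
    exact ⟨_, h, by simp [mul_assoc]⟩

theorem conjSubgroup_one (B : Subgroup G) : conjSubgroup 1 B = B := by
  ext x; rw [mem_conjSubgroup]; simp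

theorem conjSubgroup_mul (g h : G) (B : Subgroup G) :
    conjSubgroup (g * h) B = conjSubgroup g (conjSubgroup h B) := by
  ext x; simp only [mem_conjSubgroup, mul_inv_rev, mul_assoc]

theorem conjSubgroup_mono (g : G) {A B : Subgroup G} (h : A ≤ B) :
    conjSubgroup g A ≤ conjSubgroup g B := map_mono h

theorem conjSubgroup_conjSubgroup_inv (g : G) (B : Subgroup G) :
    conjSubgroup g (conjSubgroup g⁻¹ B) = B := by
  rw [← conjSubgroup_mul, mul_inv_cancel, conjSubgroup_one]

theorem conjSubgroup_eq_of_mem_normalizer {g : G} {B : Subgroup G} (h : g ∈ normalizer B) :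
    conjSubgroup g B = B := by
  ext x
  rw [mem_conjSubgroup, ← mem_normalizer_iff''.1 h x]

theorem conjSubgroup_normal (g : G) (K : Subgroup G) [K.Normal] : conjSubgroup g K = K :=
  conjSubgroup_eq_of_mem_normalizer (le_normalizer_of_normal (K := ⊤) (mem_top g))

theorem le_normalizer_conjSubgroup {K B : Subgroup G} [K.Normal] (h : K ≤ normalizer B) (g : G) :
    K ≤ normalizer (conjSubgroup g B) := by
  rw [← conjSubgroup_normal g K]
  exact (conjSubgroup_mono g h).trans (le_normalizer_map _)

theorem conjSubgroup_sInf (g : G) (S : Set (Subgroup G)) :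
    conjSubgroup g (sInf S) = sInf (conjSubgroup g '' S) := by
  ext x
  simp only [mem_conjSubgroup, mem_sInf, Set.forall_mem_image]

/-- The set of conjugates of `B`. -/
abbrev conjugateSet (B : Subgroup G) : Set (Subgroup G) := Set.range fun g => conjSubgroup g B

theorem conjSubgroup_mem_conjugateSet {B X : Subgroup G} (hX : X ∈ conjugateSet B) (g : G) :
    conjSubgroup g X ∈ conjugateSet B := by
  obtain ⟨h, rfl⟩ := hX
  exact ⟨g * h, conjSubgroup_mul g h B⟩

theorem self_mem_conjugateSet (B : Subgroup G) : B ∈ conjugateSet B := ⟨1, conjSubgroup_one B⟩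

theorem finite_conjugateSet {B K : Subgroup G} (hK : K.index ≠ 0) (h : K ≤ normalizer B) :
    (conjugateSet B).Finite := by
  have : Finite (G ⧸ K) := index_ne_zero_iff_finite.1 hK
  let f : G ⧸ K → Subgroup G := Quotient.lift (fun g => conjSubgroup g B) (by
    intro a b hab
    have hab' : a⁻¹ * b ∈ K := QuotientGroup.leftRel_apply.1 hab
    have : b = a * (a⁻¹ * b) := by group
    change conjSubgroup a B = conjSubgroup b B
    rw [this, conjSubgroup_mul, conjSubgroup_eq_of_mem_normalizer (h hab')])
  refine (Set.finite_range f).subset ?_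
  rintro _ ⟨g, rfl⟩
  exact ⟨QuotientGroup.mk g, rfl⟩

theorem iSup_conjugateSet_normal (B : Subgroup G) :
    (⨆ X : conjugateSet B, (X : Subgroup G)).Normal := by
  refine ⟨fun x hx g => ?_⟩
  have h : conjSubgroup g (⨆ X : conjugateSet B, (X : Subgroup G)) ≤
      ⨆ X : conjugateSet B, (X : Subgroup G) := by
    rw [conjSubgroup, Subgroup.map_iSup]
    exact iSup_le fun X => le_iSup (fun Y : conjugateSet B => (Y : Subgroup G))
      ⟨_, conjSubgroup_mem_conjugateSet X.2 g⟩
  exact h (mem_conjSubgroup.2 (by simpa [mul_assoc] using hx))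

end Conjugates

/-- A basal subgroup: a non-trivial subgroup, normal in a normal subgroup of finite index, which
meets its other conjugates trivially. -/
structure IsBasal {G : Type*} [Group G] (B : Subgroup G) : Prop where
  ne_bot : B ≠ ⊥
  exists_normal : ∃ K : Subgroup G, K.Normal ∧ K.index ≠ 0 ∧ B ≤ K ∧ K ≤ normalizer B
  disjoint : ∀ g, conjSubgroup g B ≠ B → Disjoint (conjSubgroup g B) B

namespace IsBasal

variable {G : Type*} [Group G] {B : Subgroup G}

theorem finite (hB : IsBasal B) : Finite (conjugateSet B) := by
  obtain ⟨K, _, hKi, _, hK⟩ := hB.exists_normal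
  exact (finite_conjugateSet hKi hK).to_subtype

theorem disjoint_of_ne (hB : IsBasal B) {X Y : Subgroup G} (hX : X ∈ conjugateSet B)
    (hY : Y ∈ conjugateSet B) (h : X ≠ Y) : Disjoint X Y := by
  obtain ⟨a, rfl⟩ := hX
  obtain ⟨b, rfl⟩ := hY
  have h1 : conjSubgroup (b⁻¹ * a) B ≠ B := by
    intro h'
    apply h
    change conjSubgroup a B = conjSubgroup b B
    nth_rewrite 2 [← h']
    rw [← conjSubgroup_mul, mul_inv_cancel_left]
  have h2 := hB.disjoint _ h1
  rw [disjoint_def] at h2 ⊢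
  intro x hx hy
  have := h2 (x := b⁻¹ * x * b) (by
    rw [mem_conjSubgroup] at hx ⊢
    simpa [mul_assoc] using hx) (mem_conjSubgroup.1 hy)
  have h3 : x = b * (b⁻¹ * x * b) * b⁻¹ := by group
  rw [h3, this]; group

/-- All conjugates lie in, and are normalized by, the same normal subgroup `K`. -/
theorem commutesWith_of_ne (hB : IsBasal B) {X Y : Subgroup G} (hX : X ∈ conjugateSet B)
    (hY : Y ∈ conjugateSet B) (h : X ≠ Y) : X.CommutesWith Y := by
  obtain ⟨K, hKn, _, hBK, hK⟩ := hB.exists_normal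
  have hle : ∀ {Z}, Z ∈ conjugateSet B → Z ≤ K := by
    rintro _ ⟨g, rfl⟩
    exact (conjSubgroup_mono g hBK).trans (conjSubgroup_normal g K).le
  have hn : ∀ {Z}, Z ∈ conjugateSet B → K ≤ normalizer (Z : Set G) := by
    rintro _ ⟨g, rfl⟩
    exact le_normalizer_conjSubgroup hK g
  exact commutesWith_of_le_normalizer ((hle hY).trans (hn hX)) ((hle hX).trans (hn hY))
    (hB.disjoint_of_ne hX hY h)

theorem commute (hB : IsBasal B) (X Y : conjugateSet B) (h : X ≠ Y) :
    (X : Subgroup G).CommutesWith (Y : Subgroup G) :=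
  hB.commutesWith_of_ne X.2 Y.2 fun h' => h (Subtype.ext h')

theorem conj (hB : IsBasal B) (g : G) : IsBasal (conjSubgroup g B) := by
  obtain ⟨K, hKn, hKi, hBK, hK⟩ := hB.exists_normal
  refine ⟨?_, ⟨K, hKn, hKi, ?_, le_normalizer_conjSubgroup hK g⟩, ?_⟩
  · intro h
    rw [conjSubgroup, map_eq_bot_iff_of_injective _ (MulAut.conj g).injective] at h
    exact hB.ne_bot h
  · exact (conjSubgroup_mono g hBK).trans (conjSubgroup_normal g K).le
  · intro h hne
    exact hB.disjoint_of_ne ⟨h * g, conjSubgroup_mul h g B⟩ ⟨g, rfl⟩ hne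

theorem conjugateSet_eq {X : Subgroup G} (hX : X ∈ conjugateSet B) :
    conjugateSet X = conjugateSet B := by
  obtain ⟨g, rfl⟩ := hX
  apply Set.Subset.antisymm
  · rintro _ ⟨h, rfl⟩
    exact ⟨h * g, conjSubgroup_mul h g B⟩
  · rintro _ ⟨h, rfl⟩
    refine ⟨h * g⁻¹, ?_⟩
    change conjSubgroup _ (conjSubgroup g B) = _
    rw [← conjSubgroup_mul]; simp

/-- Pairwise disjointness alone is not enough. An element of one conjugate that is also a product of
elements of the others commutes with every conjugate, so it is central in their product; that centre
is abelian and normal in `G`, hence trivial. -/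
theorem independent (hb : baerRadical G = ⊥) (hB : IsBasal B) :
    iSupIndep fun X : conjugateSet B => (X : Subgroup G) := by
  intro X
  rw [disjoint_def]
  intro x hx hy
  have hcX : (X : Subgroup G).CommutesWith (⨆ (Y) (_ : Y ≠ X), (Y : Subgroup G)) :=
    CommutesWith.iSup_right fun Y => CommutesWith.iSup_right fun h => hB.commute X Y h.symm
  set P := ⨆ Y : conjugateSet B, (Y : Subgroup G) with hP
  have hPn : P.Normal := iSup_conjugateSet_normal B
  have hxc : (zpowers x).CommutesWith P := by
    refine CommutesWith.iSup_right fun Y => ?_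
    by_cases h : Y = X
    · subst h
      exact (hcX.mono le_rfl ((zpowers_le).2 hy)).symm
    · exact (hB.commute X Y (Ne.symm h)).mono ((zpowers_le).2 hx) le_rfl
  refine eq_one_of_mem_commutative_normal hb (Z := P ⊓ centralizer (P : Set G)) inferInstance ?_
    ⟨le_iSup (fun Y : conjugateSet B => (Y : Subgroup G)) X hx,
      mem_centralizer_iff.2 fun p hp => (hxc x (mem_zpowers x) p hp).symm⟩
  intro a ha b hb
  exact mem_centralizer_iff.1 hb.2 a ha.1

theorem iSup_index_ne_zero (hji : IsJustInfinite G) (hB : IsBasal B) :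
    (⨆ X : conjugateSet B, (X : Subgroup G)).index ≠ 0 := by
  refine (hji.2 _ (iSup_conjugateSet_normal B) ?_).index_ne_zero
  intro h
  have := le_iSup (fun Y : conjugateSet B => (Y : Subgroup G)) ⟨B, self_mem_conjugateSet B⟩
  rw [h, le_bot_iff] at this
  exact hB.ne_bot this

/-- Otherwise the finitely many commuting conjugates would generate a finite subgroup of finite
index. -/
theorem infinite (hji : IsJustInfinite G) (hB : IsBasal B) : Infinite B := by
  by_contra hfin
  have hBf : Finite B := not_infinite_iff_finite.1 hfin
  have := hji.1
  have := hB.finite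
  have h : (⊥ : Subgroup G).relIndex (⨆ X : conjugateSet B, (X : Subgroup G)) ≠ 0 := by
    refine relIndex_iSup_ne_zero hB.commute ?_
    rintro ⟨_, g, rfl⟩
    rw [relIndex_bot_left]
    have : Finite (conjSubgroup g B) := Finite.of_equiv B
      (B.equivMapOfInjective _ (MulAut.conj g).injective).toEquiv
    exact Nat.card_pos.ne'
  have := infinite_of_index_ne_zero (hB.iSup_index_ne_zero hji)
  have := infinite_of_relIndex_ne_zero h
  exact ne_bot_of_infinite (A := (⊥ : Subgroup G)) rfl

theorem isSubnormal (hB : IsBasal B) : B.IsSubnormal := by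
  obtain ⟨K, hKn, _, hBK, hK⟩ := hB.exists_normal
  exact IsSubnormal.of_le_normalizer hBK hKn.isSubnormal hK

/-- Distinct conjugates are infinite and meet trivially, so they are not commensurable. -/
theorem card_le (hji : IsJustInfinite G) [Finite (StructureLattice G)] (hB : IsBasal B) :
    Nat.card (conjugateSet B) ≤ Nat.card (StructureLattice G) := by
  have hbas : ∀ X : conjugateSet B, IsBasal (X : Subgroup G) := by
    rintro ⟨_, g, rfl⟩
    exact hB.conj g
  let f : conjugateSet B → StructureLattice G := fun X =>
    Quotient.mk (subnormalCommensurable G) ⟨X, (hbas X).isSubnormal⟩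
  refine Nat.card_le_card_of_injective f fun X Y hXY => ?_
  by_contra hne
  have h : Commensurable (X : Subgroup G) (Y : Subgroup G) := Quotient.exact hXY
  have hd := hB.disjoint_of_ne X.2 Y.2 fun h' => hne (Subtype.ext h')
  have h1 := h.1
  rw [← inf_relIndex_right, disjoint_iff.1 hd] at h1
  have := (hbas Y).infinite hji
  have := infinite_of_relIndex_ne_zero h1
  exact ne_bot_of_infinite (A := (⊥ : Subgroup G)) rfl

/-- A non-trivial normal subgroup of a normal subgroup contains a basal subgroup. -/
theorem exists_le (hji : IsJustInfinite G) {L K : Subgroup G} (hL : L ≠ ⊥) (hLK : L ≤ K)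
    (hKn : K.Normal) (hK : K ≤ normalizer L) :
    ∃ B ≤ L, IsBasal B ∧ K ≤ normalizer B := by
  have hKi : K.index ≠ 0 :=
    (hji.2 K hKn (fun h => hL (le_bot_iff.1 (h ▸ hLK)))).index_ne_zero
  have hfin := finite_conjugateSet hKi hK
  have hF : {S : Set (Subgroup G) | S ⊆ conjugateSet L ∧ L ∈ S ∧ sInf S ≠ ⊥}.Finite :=
    hfin.finite_subsets.subset fun S hS => hS.1
  -- The basal subgroup is the intersection of a maximal family `S` of conjugates of `L` containing
  -- `L` with non-trivial intersection. If a conjugate of `sInf S` by `g` meets `sInf S`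
  -- non-trivially, maximality puts the conjugated family inside `S`.
  obtain ⟨S, hS⟩ := hF.exists_maximal ⟨{L}, by
    refine ⟨?_, rfl, by simpa using hL⟩
    rintro _ rfl
    exact self_mem_conjugateSet _⟩
  obtain ⟨⟨hSL, hLS, hSne⟩, hmax⟩ := hS
  have hle : ∀ g, ¬ Disjoint (conjSubgroup g (sInf S)) (sInf S) →
      sInf S ≤ conjSubgroup g (sInf S) := by
    intro g hg
    have hU : S ∪ conjSubgroup g '' S ∈
        {S : Set (Subgroup G) | S ⊆ conjugateSet L ∧ L ∈ S ∧ sInf S ≠ ⊥} := by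
      refine ⟨Set.union_subset hSL ?_, Or.inl hLS, ?_⟩
      · rintro _ ⟨X, hX, rfl⟩
        exact conjSubgroup_mem_conjugateSet (hSL hX) g
      · rw [sInf_union, ← conjSubgroup_sInf, inf_comm]
        exact fun h => hg (disjoint_iff.2 h)
    have := hmax hU Set.subset_union_left
    rw [conjSubgroup_sInf]
    exact sInf_le_sInf (Set.subset_union_right.trans this)
  have hKS : K ≤ normalizer (sInf S : Subgroup G) := by
    intro k hk
    rw [mem_normalizer_iff]
    have : ∀ X ∈ S, k ∈ normalizer (X : Set G) := by
      intro X hX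
      obtain ⟨g, rfl⟩ := hSL hX
      exact le_normalizer_conjSubgroup hK g hk
    intro x
    simp only [mem_sInf]
    exact forall₂_congr fun X hX => mem_normalizer_iff.1 (this X hX) x
  refine ⟨sInf S, sInf_le hLS, ⟨hSne, ⟨K, hKn, hKi, (sInf_le hLS).trans hLK, hKS⟩, ?_⟩, hKS⟩
  intro g hg
  by_contra hd
  refine hg (le_antisymm ?_ (hle g hd))
  -- The reverse inclusion is the same argument applied to `g⁻¹`.
  have h1 : ¬ Disjoint (conjSubgroup g⁻¹ (sInf S)) (sInf S) := by
    intro h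
    apply hd
    rw [disjoint_def] at h ⊢
    intro x hx hy
    have := h (x := g⁻¹ * x * g) (by rw [mem_conjSubgroup]; simpa [mul_assoc] using hy)
      (mem_conjSubgroup.1 hx)
    have h3 : x = g * (g⁻¹ * x * g) * g⁻¹ := by group
    rw [h3, this]; group
  have h2 := conjSubgroup_mono g (hle _ h1)
  rwa [conjSubgroup_conjSubgroup_inv] at h2

/-- `B` has the largest number of conjugates among basal subgroups. -/
def HasMaxConjugates (B : Subgroup G) : Prop :=
  ∀ C : Subgroup G, IsBasal C → Nat.card (conjugateSet C) ≤ Nat.card (conjugateSet B)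

/-- The whole group is basal, and the numbers of conjugates are bounded by `card_le`. -/
theorem exists_hasMaxConjugates (hji : IsJustInfinite G) [Finite (StructureLattice G)] :
    ∃ B : Subgroup G, IsBasal B ∧ HasMaxConjugates B := by
  have := hji.1
  have htop : IsBasal (⊤ : Subgroup G) := by
    have : Infinite (⊤ : Subgroup G) := infinite_of_index_ne_zero (by simp)
    exact ⟨ne_bot_of_infinite, ⟨⊤, inferInstance, by simp, le_rfl, le_normalizer_of_normal⟩,
      fun g hg => (hg (conjSubgroup_normal g ⊤)).elim⟩
  let s : Set ℕ := {k | ∃ B : Subgroup G, IsBasal B ∧ Nat.card (conjugateSet B) = k}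
  have hs : s.Finite := (Set.finite_Iic (Nat.card (StructureLattice G))).subset (by
    rintro _ ⟨B, hB, rfl⟩
    exact hB.card_le hji)
  obtain ⟨k, ⟨⟨B, hB, rfl⟩, hk⟩⟩ := hs.exists_maximal ⟨_, ⊤, htop, rfl⟩
  refine ⟨B, hB, fun C hC => ?_⟩
  by_contra hlt
  exact hlt (hk ⟨C, hC, rfl⟩ (not_le.1 hlt).le)

/-- The subgroup generated by the other conjugates of `B`. -/
abbrev others (B : Subgroup G) : Subgroup G := ⨆ X ∈ conjugateSet B \ {B}, X

theorem commutesWith_others (hB : IsBasal B) : B.CommutesWith (others B) :=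
  CommutesWith.iSup_right fun _ => CommutesWith.iSup_right fun hX =>
    hB.commutesWith_of_ne (self_mem_conjugateSet B) hX.1 (Ne.symm hX.2)

theorem disjoint_others (hb : baerRadical G = ⊥) (hB : IsBasal B) : Disjoint B (others B) := by
  refine (hB.independent hb ⟨B, self_mem_conjugateSet B⟩).mono_right ?_
  refine iSup₂_le fun X hX => ?_
  exact le_iSup₂_of_le (⟨X, hX.1⟩ : conjugateSet B) (fun h => hX.2 (congrArg Subtype.val h)) le_rfl

/-- If `B` is basal with the largest number of conjugates, a non-trivial normal subgroup of `B`
contains a basal subgroup with the same property, of finite index in `B`. -/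
theorem exists_le_of_hasMaxConjugates (hji : IsJustInfinite G) (hb : baerRadical G = ⊥)
    (hB : IsBasal B) (hmax : HasMaxConjugates B) {N : Subgroup G} (hN : N ≠ ⊥) (hNB : N ≤ B)
    (hBN : B ≤ normalizer N) :
    ∃ C ≤ N, IsBasal C ∧ HasMaxConjugates C ∧ B ≤ normalizer C ∧
      (C ⊔ others B).index ≠ 0 ∧ C.relIndex B ≠ 0 := by
  set P := ⨆ X : conjugateSet B, (X : Subgroup G) with hP
  have hBP : B ≤ P :=
    le_iSup (fun Y : conjugateSet B => (Y : Subgroup G)) ⟨B, self_mem_conjugateSet B⟩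
  have hPN : P ≤ normalizer N := by
    refine iSup_le fun X => ?_
    by_cases h : (X : Subgroup G) = B
    · rw [h]; exact hBN
    · exact ((hB.commutesWith_of_ne (self_mem_conjugateSet B) X.2 (Ne.symm h)).mono
        hNB le_rfl).le_normalizer
  obtain ⟨C, hCN, hC, hPC⟩ := exists_le hji hN (hNB.trans hBP) (iSup_conjugateSet_normal B) hPN
  have hCB := hCN.trans hNB
  have := hB.finite
  have := hC.finite
  -- Each conjugate of `C` lies in exactly one conjugate of `B`. The resulting surjection is a
  -- bijection by maximality, so `C` is its only conjugate inside `B` and the rest lie in `others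
  -- B`.
  have hex : ∀ X : conjugateSet C, ∃ Y : conjugateSet B, (X : Subgroup G) ≤ (Y : Subgroup G) := by
    rintro ⟨_, g, rfl⟩
    exact ⟨⟨_, g, rfl⟩, conjSubgroup_mono g hCB⟩
  choose f hf using hex
  have hfeq : ∀ (X : conjugateSet C) (Y : conjugateSet B), (X : Subgroup G) ≤ (Y : Subgroup G) →
      f X = Y := by
    intro X Y hXY
    by_contra hne
    have hd := hB.disjoint_of_ne (f X).2 Y.2 fun h => hne (Subtype.ext h)
    obtain ⟨g, hg⟩ := X.2
    refine (hC.conj g).ne_bot (le_bot_iff.1 ?_)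
    exact hg.le.trans (hd (hf X) hXY)
  have hsurj : Function.Surjective f := by
    rintro ⟨_, g, rfl⟩
    exact ⟨⟨_, g, rfl⟩, hfeq _ _ (conjSubgroup_mono g hCB)⟩
  have hcard : Nat.card (conjugateSet C) = Nat.card (conjugateSet B) :=
    le_antisymm (hmax C hC) (Nat.card_le_card_of_surjective f hsurj)
  have hinj : Function.Injective f :=
    ((Nat.bijective_iff_surjective_and_card f).2 ⟨hsurj, hcard⟩).1
  have hle : (⨆ X : conjugateSet C, (X : Subgroup G)) ≤ C ⊔ others B := by
    refine iSup_le fun X => ?_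
    by_cases hX : f X = ⟨B, self_mem_conjugateSet B⟩
    · have : X = ⟨C, self_mem_conjugateSet C⟩ :=
        hinj (hX.trans (hfeq ⟨C, self_mem_conjugateSet C⟩ _ hCB).symm)
      rw [this]; exact le_sup_left
    · refine le_sup_of_le_right ((hf X).trans ?_)
      exact le_iSup₂_of_le (f X : Subgroup G) ⟨(f X).2, fun h => hX (Subtype.ext h)⟩ le_rfl
  have hidx : (C ⊔ others B).index ≠ 0 := fun h0 => hC.iSup_index_ne_zero hji
    (by rw [← relIndex_top_right] at h0 ⊢; exact relIndex_eq_zero_of_le_left hle h0)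
  refine ⟨C, hCN, hC, fun D hD => hcard ▸ hmax D hD, hBP.trans hPC, hidx, ?_⟩
  have h1 : (C ⊔ others B).relIndex B ≠ 0 := fun h0 =>
    hidx (index_eq_zero_of_relIndex_eq_zero h0)
  rw [← inf_relIndex_right] at h1
  refine fun h0 => h1 (relIndex_eq_zero_of_le_left ?_ h0)
  -- Modular law: an element of `C ⊔ others B` lying in `B` has trivial component in `others B`.
  rintro x ⟨hx, hxB⟩
  obtain ⟨c, hc, y, hy, rfl⟩ :=
    (hB.commutesWith_others.mono hCB le_rfl).exists_mul_of_mem_sup hx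
  have : y = 1 := disjoint_def.1 (hB.disjoint_others hb)
    ((mul_mem_cancel_left (hCB hc)).1 hxB) hy
  simpa [this] using hc

theorem relIndex_ne_zero_of_le (hji : IsJustInfinite G) (hb : baerRadical G = ⊥)
    (hB : IsBasal B) (hmax : HasMaxConjugates B) {N : Subgroup G} (hN : N ≠ ⊥) (hNB : N ≤ B)
    (hBN : B ≤ normalizer N) : N.relIndex B ≠ 0 := by
  obtain ⟨C, hCN, -, -, -, -, h⟩ := exists_le_of_hasMaxConjugates hji hb hB hmax hN hNB hBN
  exact fun h0 => h (relIndex_eq_zero_of_le_left hCN h0)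

/-- For `D` normal in `N` normal in `B`, choose a basal `C ≤ N` that again has the most conjugates.
Then `D ⊓ C` is normal in `C`, and once it is non-trivial it has finite index in `C`, hence in `B`.
-/
theorem isHereditarilyJustInfinite (hji : IsJustInfinite G) (hb : baerRadical G = ⊥)
    (hB : IsBasal B) (hmax : HasMaxConjugates B) : IsHereditarilyJustInfinite B := by
  have hBinf := hB.infinite hji
  have hmap : ∀ N : Subgroup B, N.Normal → N ≠ ⊥ → N.map B.subtype ≠ ⊥ ∧ N.map B.subtype ≤ B ∧
      B ≤ normalizer (N.map B.subtype : Subgroup G) := by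
    intro N hN hne
    refine ⟨fun h => hne ((map_eq_bot_iff_of_injective _ B.subtype_injective).1 h),
      map_subtype_le N, ?_⟩
    rw [← normal_subgroupOf_iff_le_normalizer (map_subtype_le N)]
    rwa [subgroupOf, comap_map_eq_self_of_injective B.subtype_injective]
  have hidx : ∀ N : Subgroup B, N.Normal → N ≠ ⊥ → N.index ≠ 0 := by
    intro N hN hne
    obtain ⟨h1, h2, h3⟩ := hmap N hN hne
    have := relIndex_ne_zero_of_le hji hb hB hmax h1 h2 h3
    rwa [relIndex, subgroupOf, comap_map_eq_self_of_injective B.subtype_injective] at this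
  refine ⟨⟨hBinf, fun N hN hne => ⟨hidx N hN hne⟩⟩, fun N hN hne => ?_⟩
  refine ⟨infinite_of_index_ne_zero (hidx N hN hne), fun D hD hDne => ⟨?_⟩⟩
  obtain ⟨h1, h2, h3⟩ := hmap N hN hne
  obtain ⟨C, hCN, hC, hCmax, hBC, hCi, hCB⟩ :=
    exists_le_of_hasMaxConjugates hji hb hB hmax h1 h2 h3
  set N' := N.map B.subtype with hN'
  set D' := (D.map N.subtype).map B.subtype with hD'
  have hDN' : D' ≤ N' := map_mono (map_subtype_le D)
  have hND' : N' ≤ normalizer (D' : Set G) := by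
    have : N ≤ normalizer (D.map N.subtype : Subgroup B) := by
      rw [← normal_subgroupOf_iff_le_normalizer (map_subtype_le D)]
      rwa [subgroupOf, comap_map_eq_self_of_injective N.subtype_injective]
    exact (map_mono this).trans (le_normalizer_map _)
  have hD'ne : D' ≠ ⊥ := by
    intro h
    rw [hD', map_eq_bot_iff_of_injective _ B.subtype_injective,
      map_eq_bot_iff_of_injective _ N.subtype_injective] at h
    exact hDne h
  have hrel : D'.relIndex N' = D.index := by
    rw [hD', hN', relIndex_map_map_of_injective _ _ B.subtype_injective, relIndex, subgroupOf,
      comap_map_eq_self_of_injective N.subtype_injective]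
  rw [← hrel]
  -- Otherwise `D'` would centralize the finite-index subgroup `C ⊔ others B`.
  have hdis : ¬ Disjoint D' C := by
    intro hd
    have hcC : D'.CommutesWith C := commutesWith_of_le_normalizer (hCN.trans hND')
      ((hDN'.trans h2).trans hBC) hd
    have hcF : D'.CommutesWith (C ⊔ others B) :=
      hcC.sup_right (hB.commutesWith_others.mono (hDN'.trans h2) le_rfl)
    refine hD'ne ((eq_bot_iff_forall _).2 fun d hd => ?_)
    exact eq_one_of_commute_finiteIndex hji hb hCi fun f hf => hcF d hd f hf
  have h4 : (D' ⊓ C).relIndex C ≠ 0 := by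
    refine relIndex_ne_zero_of_le hji hb hC hCmax (fun h => hdis (disjoint_iff.2 h)) inf_le_right ?_
    exact (le_inf (hCN.trans hND') le_normalizer).trans inf_normalizer_le_normalizer_inf
  rw [inf_relIndex_right] at h4
  exact fun h0 => relIndex_ne_zero_trans h4 hCB (relIndex_eq_zero_of_le_right h2 h0)

theorem baerRadical_eq_bot (hb : baerRadical G = ⊥) (hB : IsBasal B) : baerRadical B = ⊥ := by
  refine le_bot_iff.1 (sSup_le ?_)
  rintro C ⟨hC, hcyc⟩
  have h1 : C.map B.subtype ≤ baerRadical G :=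
    le_sSup ⟨hC.trans' hB.isSubnormal, isCyclic_of_surjective
      (C.equivMapOfInjective _ B.subtype_injective)
      (C.equivMapOfInjective _ B.subtype_injective).surjective⟩
  rw [hb, le_bot_iff, map_eq_bot_iff_of_injective _ B.subtype_injective] at h1
  exact h1.le

end IsBasal

/-- The factors are the conjugates of a basal subgroup with the most conjugates, so isomorphism and
transitivity come from conjugation. -/
theorem exists_isHJIDecomposition {G : Type*} [Group G] (hji : IsJustInfinite G)
    (hb : baerRadical G = ⊥) [Finite (StructureLattice G)] :
    ∃ (n : ℕ) (H : Fin n → Subgroup G), IsHJIDecomposition H := by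
  obtain ⟨B, hB, hmax⟩ := IsBasal.exists_hasMaxConjugates hji
  have := hB.finite
  let e : Fin (Nat.card (conjugateSet B)) ≃ conjugateSet B := (Finite.equivFin _).symm
  have hbas : ∀ i, IsBasal (e i : Subgroup G) := by
    intro i
    obtain ⟨g, hg⟩ := (e i).2
    rw [← hg]
    exact hB.conj g
  have hmax' : ∀ i, IsBasal.HasMaxConjugates (e i : Subgroup G) := by
    intro i C hC
    rw [IsBasal.conjugateSet_eq (e i).2]
    exact hmax C hC
  have htrans : ∀ i j, ∃ g : G, conjSubgroup g (e i : Subgroup G) = e j := by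
    intro i j
    exact (IsBasal.conjugateSet_eq (e i).2).symm.subset (e j).2
  have hsup : (⨆ i, (e i : Subgroup G)) = ⨆ X : conjugateSet B, (X : Subgroup G) :=
    e.iSup_comp (g := fun X : conjugateSet B => (X : Subgroup G))
  refine ⟨_, fun i => (e i : Subgroup G), ?_⟩
  refine
    { commute := fun i j hij => hB.commute (e i) (e j) (e.injective.ne hij)
      independent := (hB.independent hb).comp e.injective
      normal := by rw [hsup]; exact iSup_conjugateSet_normal B
      finiteIndex := by rw [hsup]; exact ⟨hB.iSup_index_ne_zero hji⟩
      isomorphic := fun i j => ?_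
      hereditarilyJustInfinite := fun i => (hbas i).isHereditarilyJustInfinite hji hb (hmax' i)
      trivialBaerRadical := fun i => (hbas i).baerRadical_eq_bot hb
      conj_mem := fun g i => ⟨e.symm ⟨_, conjSubgroup_mem_conjugateSet (e i).2 g⟩,
        by rw [e.apply_symm_apply]⟩
      transitive := htrans }
  obtain ⟨g, hg⟩ := htrans i j
  rw [← hg]
  exact ⟨Subgroup.equivMapOfInjective _ _ (MulAut.conj g).injective⟩

end

noncomputable section

open Subgroup

/-! ## Invariance, supports and restrictions of functionals on `ℓ^∞(G)` -/

/-- The element of `ℓ^∞(X)` given by a bounded function. -/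
def LInfty.ofBounded {X : Type*} (f : X → ℂ) (C : ℝ) (h : ∀ x, ‖f x‖ ≤ C) : LInfty X :=
  ⟨f, memℓp_infty ⟨C, by rintro _ ⟨x, rfl⟩; exact h x⟩⟩

theorem LInfty.norm_apply_le {X : Type*} (l : LInfty X) (x : X) : ‖l x‖ ≤ ‖l‖ :=
  lp.norm_apply_le_norm ENNReal.top_ne_zero l x

open Classical in
/-- The product of a bounded function with the indicator function of a set. -/
def LInfty.restrict {X : Type*} (s : Set X) : LInfty X →L[ℂ] LInfty X :=
  have key : ∀ (l : LInfty X) (x : X), ‖(if x ∈ s then l x else 0 : ℂ)‖ ≤ ‖l‖ := fun l x => by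
    split_ifs
    · exact LInfty.norm_apply_le l x
    · simp
  LinearMap.mkContinuous
    { toFun := fun l => LInfty.ofBounded (fun x => if x ∈ s then l x else 0) ‖l‖ (key l)
      map_add' := fun l m => by
        ext x
        change (if x ∈ s then l x + m x else 0) =
          (if x ∈ s then l x else 0) + (if x ∈ s then m x else 0)
        split_ifs <;> simp
      map_smul' := fun c l => by
        ext x
        change (if x ∈ s then c * l x else 0) = c * (if x ∈ s then l x else 0)
        split_ifs <;> simp }
    1 (fun l => by
      rw [one_mul]
      exact lp.norm_le_of_forall_le (norm_nonneg l) (key l))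

open Classical in
theorem LInfty.restrict_apply {X : Type*} (s : Set X) (l : LInfty X) (x : X) :
    LInfty.restrict s l x = if x ∈ s then l x else 0 := rfl

namespace L1Bidual

/-- `Φ` is supported on `S`: it vanishes on all functions that are zero on `S`. -/
def IsSupportedOn {X : Type*} (Φ : L1Bidual X) (S : Set X) : Prop :=
  ∀ l : LInfty X, (∀ x ∈ S, l x = 0) → Φ l = 0

theorem IsSupportedOn.congr {X : Type*} {Φ : L1Bidual X} {S : Set X} (h : Φ.IsSupportedOn S)
    {l m : LInfty X}
    (hlm : ∀ x ∈ S, l x = m x) : Φ l = Φ m := by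
  rw [← sub_eq_zero, ← map_sub]
  refine h _ fun x hx => ?_
  change l x - m x = 0
  rw [hlm x hx, sub_self]

section Group

variable {G : Type*} [Group G]

theorem pointMass_mul_apply (s : G) (Φ : L1Bidual G) (l : LInfty G) :
    (pointMass s * Φ) l = Φ (LInfty.pullback (fun t => s * t) l) := rfl

theorem one_pointMass_mul (Φ : L1Bidual G) : pointMass 1 * Φ = Φ := by
  ext l
  rw [pointMass_mul_apply]
  congr 1
  ext t
  simp

theorem mul_pointMass_one (Φ : L1Bidual G) : Φ * pointMass 1 = Φ := by
  ext l
  rw [mul_apply]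
  congr 1
  ext t
  change l (t * 1) = l t
  rw [mul_one]

theorem pointMass_mul_pointMass (s t : G) :
    pointMass s * pointMass t = (pointMass (s * t) : L1Bidual G) := rfl

/-- The subgroup of all `s` with `δ_s □ Ψ = Ψ`. -/
def stabilizer (Ψ : L1Bidual G) : Subgroup G where
  carrier := {s | pointMass s * Ψ = Ψ}
  one_mem' := one_pointMass_mul Ψ
  mul_mem' {a b} ha hb := by
    change pointMass (a * b) * Ψ = Ψ
    change pointMass a * Ψ = Ψ at ha
    change pointMass b * Ψ = Ψ at hb
    rw [← pointMass_mul_pointMass, mul_assoc, hb, ha]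
  inv_mem' {a} ha := by
    change pointMass a⁻¹ * Ψ = Ψ
    change pointMass a * Ψ = Ψ at ha
    nth_rewrite 1 [← ha]
    rw [← mul_assoc, pointMass_mul_pointMass, inv_mul_cancel, one_pointMass_mul]

theorem mem_stabilizer {Ψ : L1Bidual G} {s : G} : s ∈ stabilizer Ψ ↔ pointMass s * Ψ = Ψ := Iff.rfl

theorem conj_mem_stabilizer {Ψ : L1Bidual G} {s : G} (h : s ∈ stabilizer Ψ) (t : G) :
    t * s * t⁻¹ ∈ stabilizer (pointMass t * Ψ) := by
  rw [mem_stabilizer, ← mul_assoc, pointMass_mul_pointMass, inv_mul_cancel_right,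
    ← pointMass_mul_pointMass, mul_assoc, mem_stabilizer.1 h]

theorem stabilizer_le_mul (Φ Ψ : L1Bidual G) : stabilizer Φ ≤ stabilizer (Φ * Ψ) := by
  intro s hs
  rw [mem_stabilizer] at hs ⊢
  rw [← mul_assoc, hs]

/-- An invariant difference on the subgroup `M`, as an element of `ℓ¹(G)**`. -/
structure IsInvariantDifferenceOn (Φ : L1Bidual G) (M : Subgroup G) : Prop where
  le_stabilizer : M ≤ stabilizer Φ
  map_one : Φ 1 = 0
  supported : Φ.IsSupportedOn M

theorem IsInvariantDifference.isInvariantDifferenceOn {H : Subgroup G} {Γ : L1Bidual H}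
    (hΓ : IsInvariantDifference Γ) :
    IsInvariantDifferenceOn (push (fun h : H => (h : G)) Γ) H where
  le_stabilizer s hs := by
    rw [mem_stabilizer]
    ext l
    have h := DFunLike.congr_fun (hΓ.1 ⟨s, hs⟩) (LInfty.pullback (fun h : H => (h : G)) l)
    exact h
  map_one := hΓ.2
  supported l hl := by
    have h : LInfty.pullback (fun h : H => (h : G)) l = 0 := by
      ext x
      exact hl x x.2
    change Γ (LInfty.pullback (fun h : H => (h : G)) l) = 0
    rw [h, map_zero]

/-- An invariant difference on `L` decomposes over the cosets of a subgroup `M` of finite index. -/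
theorem IsInvariantDifferenceOn.exists_restrict {Φ : L1Bidual G} {L M : Subgroup G}
    (hΦ : Φ.IsInvariantDifferenceOn L) (hML : M ≤ L) (hM : M.relIndex L ≠ 0) :
    ∃ Φ' : L1Bidual G, Φ'.IsInvariantDifferenceOn M ∧
      ∃ s : Finset G, Φ = ∑ t ∈ s, pointMass t * Φ' := by
  classical
  have : Finite (L ⧸ M.subgroupOf L) := index_ne_zero_iff_finite.1 hM
  have := Fintype.ofFinite (L ⧸ M.subgroupOf L)
  let Φ' : L1Bidual G := Φ.comp (LInfty.restrict (M : Set G))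
  let r : L ⧸ M.subgroupOf L → G := fun q => ((q.out : L) : G)
  have hr : Function.Injective r := fun a b hab => by
    have : a.out = b.out := Subtype.ext hab
    rw [← QuotientGroup.out_eq' a, this, QuotientGroup.out_eq' b]
  have hrL : ∀ q, r q ∈ L := fun q => q.out.2
  -- By invariance of `Φ`, translating its restriction to `M` gives its restriction to the coset `r
  -- q M`; these cosets partition `L`.
  have htrans : ∀ q (l : LInfty G), (pointMass (r q) * Φ') l =
      Φ (LInfty.restrict {x | (r q)⁻¹ * x ∈ M} l) := by
    intro q l
    have h := DFunLike.congr_fun (mem_stabilizer.1 (hΦ.le_stabilizer (hrL q)))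
      (LInfty.restrict {x | (r q)⁻¹ * x ∈ M} l)
    rw [← h, pointMass_mul_apply, pointMass_mul_apply]
    change Φ _ = Φ _
    congr 1
    ext x
    simp [LInfty.restrict_apply]
  have hsum : Φ = ∑ q, pointMass (r q) * Φ' := by
    ext l
    rw [_root_.sum_apply]
    simp only [htrans]
    rw [← map_sum]
    refine hΦ.supported.congr fun x hx => ?_
    rw [lp.coeFn_sum, Finset.sum_apply]
    rw [Finset.sum_eq_single (QuotientGroup.mk (⟨x, hx⟩ : L) : L ⧸ M.subgroupOf L)]
    · rw [LInfty.restrict_apply, if_pos]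
      have h := QuotientGroup.out_eq' (QuotientGroup.mk (⟨x, hx⟩ : L) : L ⧸ M.subgroupOf L)
      exact mem_subgroupOf.1 (QuotientGroup.eq.1 h)
    · intro q _ hq
      rw [LInfty.restrict_apply, if_neg]
      intro hm
      apply hq
      rw [← QuotientGroup.out_eq' q]
      exact QuotientGroup.eq.2 (mem_subgroupOf.2 hm)
    · simp
  have hMs : M ≤ stabilizer Φ' := by
    intro s hs
    rw [mem_stabilizer]
    ext l
    have h := DFunLike.congr_fun (mem_stabilizer.1 (hΦ.le_stabilizer (hML hs)))
      (LInfty.restrict (M : Set G) l)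
    refine Eq.trans ?_ h
    rw [pointMass_mul_apply, pointMass_mul_apply]
    change Φ _ = Φ _
    congr 1
    ext x
    simp [LInfty.restrict_apply, mul_mem_cancel_left hs]
  refine ⟨Φ', ⟨hMs, ?_, ?_⟩, Finset.univ.map ⟨r, hr⟩, by simpa using hsum⟩
  -- All coset pieces have the same value at `1`, so that value is zero.
  · have h1 : Φ 1 = Nat.card (L ⧸ M.subgroupOf L) * Φ' 1 := by
      have : ∀ q, (pointMass (r q) * Φ') 1 = Φ' 1 := fun q => rfl
      rw [Nat.card_eq_fintype_card]
      nth_rewrite 1 [hsum]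
      rw [_root_.sum_apply]
      simp [this]
    rw [hΦ.map_one] at h1
    have h2 : (Nat.card (L ⧸ M.subgroupOf L) : ℂ) ≠ 0 := Nat.cast_ne_zero.2 hM
    exact (mul_eq_zero.1 h1.symm).resolve_left h2
  · intro l hl
    change Φ (LInfty.restrict (M : Set G) l) = 0
    have : LInfty.restrict (M : Set G) l = 0 := by
      ext x
      rw [LInfty.restrict_apply]
      split_ifs with h
      · exact hl x h
      · rfl
    rw [this, map_zero]

/-- An invariant difference annihilates every functional invariant under its subgroup. -/
theorem IsInvariantDifferenceOn.mul_eq_zero {Φ Ψ : L1Bidual G} {M : Subgroup G}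
    (hΦ : Φ.IsInvariantDifferenceOn M) (hΨ : M ≤ stabilizer Ψ) : Φ * Ψ = 0 := by
  ext l
  rw [mul_apply]
  -- The function `act Ψ l` is constant on `M`, the support of `Φ`.
  have h : Φ (act Ψ l) = Φ (Ψ l • 1) := by
    refine hΦ.supported.congr fun x hx => ?_
    change (pointMass x * Ψ) l = Ψ l * 1
    rw [mem_stabilizer.1 (hΨ hx), mul_one]
  rw [h, map_smul, hΦ.map_one, smul_zero]
  rfl

/-- Elements stabilizing `Ψ` and centralizing a support of `Φ` stabilize `Φ □ Ψ`. -/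
theorem IsSupportedOn.mem_stabilizer_mul {Φ Ψ : L1Bidual G} {S : Set G} (hΦ : Φ.IsSupportedOn S)
    {s : G} (hs : s ∈ stabilizer Ψ) (hcomm : ∀ x ∈ S, x * s = s * x) :
    s ∈ stabilizer (Φ * Ψ) := by
  -- Left and right translation by `s` agree on the support of `Φ`.
  have h : pointMass s * Φ = Φ * pointMass s := by
    ext l
    rw [pointMass_mul_apply, mul_apply]
    refine hΦ.congr fun x hx => ?_
    change l (s * x) = l (x * s)
    rw [hcomm x hx]
  rw [mem_stabilizer, ← mul_assoc, h, mul_assoc, mem_stabilizer.1 hs]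

end Group

end L1Bidual

end

noncomputable section

open Subgroup

/-! ## The upper bound on the index of nilpotency -/

namespace IsHJIDecomposition

variable {G : Type*} [Group G] {n : ℕ} {H : Fin n → Subgroup G}

theorem commutesWith (hH : IsHJIDecomposition H) (i j : Fin n) (hij : i ≠ j) :
    (H i).CommutesWith (H j) := hH.commute i j hij

theorem commutesWith_iSup_ne (hH : IsHJIDecomposition H) (j : Fin n) :
    (H j).CommutesWith (⨆ (i) (_ : i ≠ j), H i) :=
  CommutesWith.iSup_right fun i => CommutesWith.iSup_right fun h => hH.commutesWith j i h.symm

theorem iSup_eq_sup (H : Fin n → Subgroup G) (j : Fin n) :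
    (⨆ i, H i) = H j ⊔ ⨆ (i) (_ : i ≠ j), H i := by
  refine le_antisymm (iSup_le fun i => ?_) (sup_le (le_iSup H j) (iSup₂_le fun i _ => le_iSup H i))
  by_cases h : i = j
  · subst h; exact le_sup_left
  · exact le_sup_of_le_right (le_iSup₂_of_le i h le_rfl)

theorem isSubnormal (hH : IsHJIDecomposition H) (j : Fin n) : (H j).IsSubnormal := by
  refine IsSubnormal.of_le_normalizer (le_iSup H j) hH.normal.isSubnormal ?_
  rw [iSup_eq_sup H j]
  exact sup_le le_normalizer (hH.commutesWith_iSup_ne j).le_normalizer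

theorem infinite (hH : IsHJIDecomposition H) (j : Fin n) : Infinite (H j) :=
  (hH.hereditarilyJustInfinite j).1.1

theorem injective (hH : IsHJIDecomposition H) : Function.Injective H := by
  intro i j hij
  by_contra hne
  have := hH.infinite i
  have h := hH.independent.pairwiseDisjoint hne
  rw [Function.onFun, ← hij, disjoint_self] at h
  exact ne_bot_of_infinite h

/-- A subnormal subgroup with non-trivial projection to a factor meets it in a subgroup of finite
index. -/
theorem relIndex_ne_zero_of_isSubnormal (hH : IsHJIDecomposition H) {L : Subgroup G}
    (hL : L.IsSubnormal) (j : Fin n) (hj : ¬ L ⊓ (⨆ i, H i) ≤ ⨆ (i) (_ : i ≠ j), H i) :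
    L.relIndex (H j) ≠ 0 := by
  induction hL with
  | top => simp
  | step D L hDL hL hN ih =>
    have hD : D.IsSubnormal := IsSubnormal.step D L hDL hL hN
    have hLi := ih fun h => hj ((inf_le_inf_right _ hDL).trans h)
    refine ((hH.hereditarilyJustInfinite j).eq_bot_or_index_ne_zero (hH.trivialBaerRadical j)
      (hD.subgroupOf (K := H j))).resolve_left fun hbot => ?_
    obtain ⟨x, ⟨hxD, hxK⟩, hx⟩ := SetLike.not_le_iff_exists.1 hj
    rw [SetLike.mem_coe, iSup_eq_sup H j] at hxK
    obtain ⟨h, hh, c, hc, rfl⟩ := (hH.commutesWith_iSup_ne j).exists_mul_of_mem_sup hxK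
    have hLD : L ≤ normalizer D := (normal_subgroupOf_iff_le_normalizer hDL).1 hN
    -- Suppose `D` meets `H j` trivially. For `y` in `L ⊓ H j` the commutator of `h * c` and `y`
    -- equals that of `h` and `y`, so it lies in `D ⊓ H j` and is trivial. Thus `h` centralizes a
    -- finite-index subgroup of `H j`.
    have h1 : (⟨h, hh⟩ : H j) = 1 := by
      refine eq_one_of_commute_finiteIndex (hH.hereditarilyJustInfinite j).1
        (hH.trivialBaerRadical j) (F := L.subgroupOf (H j)) hLi ?_
      rintro ⟨y, hy⟩ hyL
      rw [mem_subgroupOf] at hyL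
      have hyL : y ∈ L := hyL
      have hcy : y * c = c * y := hH.commutesWith_iSup_ne j y hy c hc
      have hmem : h * y * h⁻¹ * y⁻¹ ∈ D := by
        have h2 : h * c * (y * (h * c)⁻¹ * y⁻¹) ∈ D :=
          mul_mem hxD ((mem_normalizer_iff.1 (hLD hyL) _).1 (inv_mem hxD))
        have h3 : h * c * (y * (h * c)⁻¹ * y⁻¹) = h * y * h⁻¹ * y⁻¹ := by
          calc h * c * (y * (h * c)⁻¹ * y⁻¹) = h * (c * y) * c⁻¹ * h⁻¹ * y⁻¹ := by group
            _ = h * (y * c) * c⁻¹ * h⁻¹ * y⁻¹ := by rw [hcy]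
            _ = h * y * h⁻¹ * y⁻¹ := by group
        rwa [h3] at h2
      have hmemH : h * y * h⁻¹ * y⁻¹ ∈ H j :=
        mul_mem (mul_mem (mul_mem hh hy) (inv_mem hh)) (inv_mem hy)
      have h4 : (⟨_, hmemH⟩ : H j) ∈ D.subgroupOf (H j) := mem_subgroupOf.2 hmem
      rw [hbot, mem_bot] at h4
      have h5 : h * y * h⁻¹ * y⁻¹ = 1 := congrArg Subtype.val h4
      refine Subtype.ext ?_
      change h * y = y * h
      calc h * y = (h * y * h⁻¹ * y⁻¹) * (y * h) := by group
        _ = y * h := by rw [h5, one_mul]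
    have h2 : h = 1 := congrArg Subtype.val h1
    exact hx (by simpa [h2] using hc)

open L1Bidual

/-- The functionals invariant under subgroups of finite index of at least `k` factors span this
subspace. -/
def invariantSpan (H : Fin n → Subgroup G) (k : ℕ) : Submodule ℂ (L1Bidual G) :=
  Submodule.span ℂ {Ψ | ∃ J : Finset (Fin n), k ≤ J.card ∧
    ∀ j ∈ J, (stabilizer Ψ).relIndex (H j) ≠ 0}

theorem invariantSpan_succ_le (H : Fin n → Subgroup G) (k : ℕ) :
    invariantSpan H (k + 1) ≤ invariantSpan H k :=
  Submodule.span_mono fun _ ⟨J, hJ, h⟩ => ⟨J, (Nat.le_succ k).trans hJ, h⟩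

theorem invariantSpan_zero (H : Fin n → Subgroup G) : invariantSpan H 0 = ⊤ :=
  eq_top_iff.2 fun _ _ => Submodule.subset_span ⟨∅, Nat.zero_le _, by simp⟩

theorem invariantSpan_eq_bot (H : Fin n → Subgroup G) : invariantSpan H (n + 1) = ⊥ := by
  refine Submodule.span_eq_bot.2 ?_
  rintro Ψ ⟨J, hJ, -⟩
  have := J.card_le_univ
  rw [Fintype.card_fin] at this
  omega

/-- Translation by `t` conjugates the stabilizer, and conjugation permutes the factors, so `J` is
replaced by an image of the same size. -/
theorem pointMass_mul_mem_invariantSpan (hH : IsHJIDecomposition H) (t : G) {Ψ : L1Bidual G}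
    {J : Finset (Fin n)} (hJ : ∀ j ∈ J, (stabilizer Ψ).relIndex (H j) ≠ 0) :
    pointMass t * Ψ ∈ invariantSpan H J.card := by
  choose σ hσ using hH.conj_mem t
  have hinj : Function.Injective σ := by
    intro i j hij
    apply hH.injective
    refine map_injective (MulAut.conj t).injective (?_ : (H i).map (MulAut.conj t).toMonoidHom =
      (H j).map (MulAut.conj t).toMonoidHom)
    rw [hσ, hσ, hij]
  refine Submodule.subset_span ⟨J.map ⟨σ, hinj⟩, by simp, ?_⟩
  intro j hj
  obtain ⟨i, hi, rfl⟩ := Finset.mem_map.1 hj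
  change (stabilizer (pointMass t * Ψ)).relIndex (H (σ i)) ≠ 0
  rw [← hσ i]
  have h1 := hJ i hi
  rw [← relIndex_map_map_of_injective (f := (MulAut.conj t).toMonoidHom) _ _
    (MulAut.conj t).injective] at h1
  refine fun h0 => h1 (relIndex_eq_zero_of_le_left ?_ h0)
  rintro _ ⟨s, hs, rfl⟩
  exact conj_mem_stabilizer hs t

/-- The heart of the upper bound. Let `S` be the set of factors onto which `L ⊓ K` projects
non-trivially: `L` contains a finite-index subgroup of each of these and `L ⊓ K` lies in their
product. The two cases are whether or not `S` brings a factor outside `J`. -/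
theorem mul_mem_invariantSpan_of_relIndex (hH : IsHJIDecomposition H) {L : Subgroup G}
    (hL : L.IsSubnormal) {Φ Ψ : L1Bidual G} (hΦ : Φ.IsInvariantDifferenceOn L)
    {J : Finset (Fin n)} (hJ : ∀ j ∈ J, (stabilizer Ψ).relIndex (H j) ≠ 0) :
    Φ * Ψ ∈ invariantSpan H (J.card + 1) := by
  classical
  set K := ⨆ i, H i with hK
  have hKL : (L ⊓ K).relIndex L ≠ 0 := by
    rw [inf_relIndex_left]
    exact fun h0 => hH.finiteIndex.index_ne_zero (index_eq_zero_of_relIndex_eq_zero h0)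
  let S : Finset (Fin n) := Finset.univ.filter fun j => ¬ L ⊓ K ≤ ⨆ (i) (_ : i ≠ j), H i
  have hS : ∀ j ∈ S, L.relIndex (H j) ≠ 0 := fun j hj =>
    hH.relIndex_ne_zero_of_isSubnormal hL j (Finset.mem_filter.1 hj).2
  have hS' : ∀ j ∉ S, L ⊓ K ≤ ⨆ (i) (_ : i ≠ j), H i := fun j hj => by
    by_contra h
    exact hj (Finset.mem_filter.2 ⟨Finset.mem_univ j, h⟩)
  -- If `S ⊆ J`, a finite-index subgroup of `L` stabilizes `Ψ`; restricting `Φ` to it gives an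
  -- invariant difference that annihilates `Ψ`.
  by_cases hSJ : S ⊆ J
  · have hle : L ⊓ K ≤ ⨆ i ∈ S, H i := by
      intro x hx
      have h := iInf_iSup_ne_le hH.commutesWith hH.independent Sᶜ hx.2
        fun j hj => hS' j (Finset.mem_compl.1 hj) hx
      simpa using h
    have h1 : (stabilizer Ψ).relIndex (L ⊓ K) ≠ 0 := fun h0 =>
      relIndex_biSup_ne_zero hH.commutesWith S (fun j hj => hJ j (hSJ hj))
        (relIndex_eq_zero_of_le_right hle h0)
    have h2 : (stabilizer Ψ ⊓ (L ⊓ K)).relIndex L ≠ 0 := by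
      rw [← inf_relIndex_right] at h1
      exact relIndex_ne_zero_trans h1 hKL
    obtain ⟨Φ', hΦ', s, rfl⟩ := hΦ.exists_restrict (inf_le_right.trans inf_le_left) h2
    rw [Finset.sum_mul]
    simp only [mul_assoc, hΦ'.mul_eq_zero inf_le_left, mul_zero, Finset.sum_const_zero]
    exact zero_mem _
  · obtain ⟨j₀, hj₀S, hj₀J⟩ := Finset.not_subset.1 hSJ
    obtain ⟨Φ', hΦ', s, rfl⟩ := hΦ.exists_restrict inf_le_left hKL
    rw [Finset.sum_mul, ← Finset.card_insert_of_notMem hj₀J]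
    refine Submodule.sum_mem _ fun t _ => ?_
    rw [mul_assoc]
    refine hH.pointMass_mul_mem_invariantSpan t ?_
    -- Along `S`, invariance is inherited from `Φ'`. Along `J` outside `S` it is inherited from `Ψ`,
    -- because those factors commute with `L ⊓ K`, which supports `Φ'`. Together this covers `insert
    -- j₀ J`.
    have hcase : ∀ j ∈ S, (stabilizer (Φ' * Ψ)).relIndex (H j) ≠ 0 := by
      intro j hj h0
      have h1 := hS j hj
      rw [← inf_relIndex_right] at h1
      refine h1 (relIndex_eq_zero_of_le_left ?_ h0)
      exact (inf_le_inf_left L (le_iSup H j)).trans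
        (hΦ'.le_stabilizer.trans (stabilizer_le_mul _ _))
    intro j hj
    by_cases hjS : j ∈ S
    · exact hcase j hjS
    · have hjJ : j ∈ J := (Finset.mem_insert.1 hj).resolve_left fun h => hjS (h ▸ hj₀S)
      have h1 := hJ j hjJ
      rw [← inf_relIndex_right] at h1
      refine fun h0 => h1 (relIndex_eq_zero_of_le_left ?_ h0)
      intro s hs
      refine hΦ'.supported.mem_stabilizer_mul hs.1 fun x hx => ?_
      exact (hH.commutesWith_iSup_ne j s hs.2 x (hS' j hjS hx)).symm

theorem mul_mem_invariantSpan_of_isInvariantDifferenceOn (hH : IsHJIDecomposition H)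
    {L : Subgroup G} (hL : L.IsSubnormal) {Φ : L1Bidual G} (hΦ : Φ.IsInvariantDifferenceOn L)
    {k : ℕ} {Ψ : L1Bidual G} (hΨ : Ψ ∈ invariantSpan H k) :
    Φ * Ψ ∈ invariantSpan H (k + 1) := by
  induction hΨ using Submodule.span_induction with
  | mem Ψ h =>
    obtain ⟨J, hJ, h⟩ := h
    have hle : invariantSpan H (J.card + 1) ≤ invariantSpan H (k + 1) :=
      Submodule.span_mono fun _ ⟨J', hJ', h'⟩ => ⟨J', by omega, h'⟩
    exact hle (hH.mul_mem_invariantSpan_of_relIndex hL hΦ h)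
  | zero => rw [mul_zero]; exact zero_mem _
  | add x y _ _ hx hy => rw [mul_add]; exact add_mem hx hy
  | smul c x _ hx => rw [mul_smul_comm]; exact Submodule.smul_mem _ c hx

theorem mul_mem_invariantSpan (hH : IsHJIDecomposition H) {Φ : L1Bidual G} (hΦ : Φ ∈ Asn G)
    {k : ℕ} {Ψ : L1Bidual G} (hΨ : Ψ ∈ invariantSpan H k) :
    Φ * Ψ ∈ invariantSpan H (k + 1) := by
  induction hΦ using NonUnitalAlgebra.adjoin_induction generalizing k Ψ with
  | mem Φ h =>
    obtain ⟨L, hL, Γ, hΓ, rfl⟩ := h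
    exact hH.mul_mem_invariantSpan_of_isInvariantDifferenceOn hL hΓ.isInvariantDifferenceOn hΨ
  | zero => rw [zero_mul]; exact zero_mem _
  | add x y _ _ hx hy => rw [add_mul]; exact add_mem (hx hΨ) (hy hΨ)
  | smul c x _ hx => rw [smul_mul_assoc]; exact Submodule.smul_mem _ c (hx hΨ)
  | mul x y _ _ hx hy => rw [mul_assoc]; exact invariantSpan_succ_le H _ (hx (hy hΨ))

theorem algebraPowSucc_le_invariantSpan (hH : IsHJIDecomposition H) (k : ℕ) :
    algebraPowSucc (Asn G) k ≤ invariantSpan H (k + 1) := by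
  induction k with
  | zero =>
    intro Φ hΦ
    -- `δ_1` is a right identity lying in level `0`, so one multiplication already gives level `1`.
    rw [← mul_pointMass_one Φ]
    exact hH.mul_mem_invariantSpan hΦ (by rw [invariantSpan_zero]; trivial)
  | succ k ih =>
    refine Submodule.span_le.2 ?_
    rintro _ ⟨x, hx, y, hy, rfl⟩
    exact hH.mul_mem_invariantSpan hx (ih hy)

theorem algebraPowSucc_eq_bot (hH : IsHJIDecomposition H) : algebraPowSucc (Asn G) n = ⊥ := by
  rw [← le_bot_iff, ← invariantSpan_eq_bot H]
  exact hH.algebraPowSucc_le_invariantSpan n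

end IsHJIDecomposition

end

noncomputable section

open Subgroup

/-! ## Disjoint thick sets in infinite groups -/

section Thick

open Cardinal

universe u

theorem Cardinal.mk_iUnion_finite_lt {ι α : Type u} [Infinite α] {S : ι → Set α}
    (hS : ∀ i, (S i).Finite) (hι : #ι < #α) : #(⋃ i, S i) < #α := by
  rcases finite_or_infinite ι with h | h
  · exact (lt_aleph0_iff_set_finite.2 (Set.finite_iUnion hS)).trans_le (aleph0_le_mk α)
  · refine lt_of_le_of_lt (mk_iUnion_le S) (lt_of_le_of_lt ?_ hι)
    calc #ι * ⨆ i, #(S i) ≤ #ι * ℵ₀ := by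
          gcongr
          exact ciSup_le' fun i => (lt_aleph0_iff_set_finite.2 (hS i)).le
      _ = #ι := mul_aleph0_eq (aleph0_le_mk ι)

/-- A subset of a group is thick if it contains a right translate of every finite set. -/
def IsThick {G : Type*} [Group G] (A : Set G) : Prop := ∀ F : Finset G, ∃ g, ∀ s ∈ F, s * g ∈ A

/-- Pairs of a finite set and a Boolean can be indexed by the initial ordinal of `#G`. By
transfinite recursion, choose for each pair a translate of its finite set disjoint from all earlier
ones: fewer than `#G` finite sets of translating elements are excluded. The Boolean decides which of
the two thick sets receives the translate. -/
theorem exists_disjoint_isThick (G : Type u) [Group G] [Infinite G] :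
    ∃ A B : Set G, IsThick A ∧ IsThick B ∧ Disjoint A B := by
  classical
  have hcard : #((#G).ord.ToType) = #(Finset G × Bool) := by
    rw [mk_ord_toType, mk_prod, mk_finset_of_infinite, mk_bool, lift_uzero, lift_ofNat]
    refine (mul_eq_left (aleph0_le_mk G) ?_ two_ne_zero).symm
    exact (natCast_lt_aleph0 (n := 2)).le.trans (aleph0_le_mk G)
  obtain ⟨e⟩ := Cardinal.eq.1 hcard
  have hex : ∀ (i : (#G).ord.ToType) (f : ∀ j, j < i → G), ∃ g : G, ∀ j (hj : j < i),
      ∀ a ∈ (e i).1, ∀ b ∈ (e j).1, a * g ≠ b * f j hj := by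
    intro i f
    let S : Set.Iio i → Set G := fun j =>
      (fun p : G × G => p.1⁻¹ * (p.2 * f j j.2)) '' ((e i).1 ×ˢ (e j).1 : Finset (G × G))
    have hS : ∀ j, (S j).Finite := fun j => (Finset.finite_toSet _).image _
    have hlt : #(⋃ j, S j) < #G := mk_iUnion_finite_lt hS (by simpa using mk_Iio_lt i)
    have hne : (⋃ j, S j) ≠ Set.univ := fun h => by
      rw [h, mk_univ] at hlt
      exact lt_irrefl _ hlt
    obtain ⟨g, hg⟩ := (Set.ne_univ_iff_exists_notMem _).1 hne
    refine ⟨g, fun j hj a ha b hb hab => hg (Set.mem_iUnion.2 ⟨⟨j, hj⟩, (a, b), ?_, ?_⟩)⟩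
    · simp [ha, hb]
    · change a⁻¹ * (b * f j hj) = g
      rw [← hab, inv_mul_cancel_left]
  choose step hstep using hex
  let g : (#G).ord.ToType → G := WellFounded.fix (C := fun _ => G) wellFounded_lt step
  have hg : ∀ i j, j < i → ∀ a ∈ (e i).1, ∀ b ∈ (e j).1, a * g i ≠ b * g j := by
    intro i j hj
    have : g i = step i fun j _ => g j := WellFounded.fix_eq _ _ _
    rw [this]
    exact hstep i (fun j _ => g j) j hj
  have hthick : ∀ b : Bool, IsThick {x | ∃ i, (e i).2 = b ∧ ∃ a ∈ (e i).1, a * g i = x} :=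
    fun b F => ⟨g (e.symm (F, b)), fun s hs => ⟨e.symm (F, b), by simp, s, by simpa using hs, rfl⟩⟩
  refine ⟨_, _, hthick true, hthick false, Set.disjoint_left.2 ?_⟩
  rintro x ⟨i, hi, a, ha, hax⟩ ⟨j, hj, b, hb, hbx⟩
  rcases lt_trichotomy i j with h | rfl | h
  · exact hg j i h b hb a ha (hbx.trans hax.symm)
  · rw [hi] at hj; exact Bool.noConfusion hj
  · exact hg i j h a ha b hb (hax.trans hbx.symm)

end Thick

/-! ## Invariant differences on infinite amenable groups -/

namespace L1Bidual

open Filter Topology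

theorem exists_tendsto_ultrafilter {X : Type*} (U : Ultrafilter X) (l : LInfty X) :
    ∃ z, ‖z‖ ≤ ‖l‖ ∧ Tendsto (fun x => l x) U (𝓝 z) := by
  obtain ⟨z, hz, h⟩ := (isCompact_closedBall (0 : ℂ) ‖l‖).ultrafilter_le_nhds'
    (U.map fun x => l x) (Ultrafilter.mem_map.2 (Eventually.of_forall fun x => by
      simpa using LInfty.norm_apply_le l x))
  exact ⟨z, by simpa using hz, h⟩

/-- The limit of bounded functions along an ultrafilter. -/
def ultrafilterLimit {X : Type*} (U : Ultrafilter X) : L1Bidual X :=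
  have hlim : ∀ l : LInfty X,
      Tendsto (fun x => l x) U (𝓝 (exists_tendsto_ultrafilter U l).choose) :=
    fun l => (exists_tendsto_ultrafilter U l).choose_spec.2
  LinearMap.mkContinuous
    { toFun := fun l => (exists_tendsto_ultrafilter U l).choose
      map_add' := fun l m => tendsto_nhds_unique (hlim (l + m)) ((hlim l).add (hlim m))
      map_smul' := fun c l => tendsto_nhds_unique (hlim (c • l)) ((hlim l).const_mul c) }
    1 (fun l => by
      rw [one_mul]
      exact (exists_tendsto_ultrafilter U l).choose_spec.1)

theorem tendsto_ultrafilterLimit {X : Type*} (U : Ultrafilter X) (l : LInfty X) :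
    Tendsto (fun x => l x) U (𝓝 (ultrafilterLimit U l)) :=
  (exists_tendsto_ultrafilter U l).choose_spec.2

theorem ultrafilterLimit_eq {X : Type*} {U : Ultrafilter X} {l : LInfty X} {z : ℂ}
    (h : ∀ᶠ x in U, l x = z) : ultrafilterLimit U l = z :=
  tendsto_nhds_unique (tendsto_ultrafilterLimit U l)
    (tendsto_const_nhds.congr' (h.mono fun _ hx => hx.symm))

variable {G : Type*} [Group G]

/-- For a thick set `A`, a left-invariant functional normalized at `1` can be averaged to one
concentrated on `A`. -/
theorem IsLeftInvariant.exists_of_isThick {M : L1Bidual G} (hM : IsLeftInvariant M)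
    (hM1 : M 1 = 1) {A : Set G} (hA : IsThick A) :
    ∃ N : L1Bidual G, IsLeftInvariant N ∧
      ∀ (l : LInfty G) (z : ℂ), (∀ x ∈ A, l x = z) → N l = z := by
  classical
  -- Thickness makes this filter proper. Along an ultrafilter below it, `s * g` is eventually in `A`
  -- for each `s`, so `M □ lim` only sees values on `A` and stays left-invariant.
  let f : Filter G := ⨅ F : Finset G, 𝓟 {g | ∀ s ∈ F, s * g ∈ A}
  have hf : f.NeBot := by
    refine iInf_neBot_of_directed' ?_ fun F => principal_neBot_iff.2 (hA F)
    intro F F'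
    refine ⟨F ∪ F', ?_, ?_⟩ <;> refine principal_mono.2 fun g hg s hs => hg s ?_ <;> simp [hs]
  have hU : ∀ s : G, ∀ᶠ g in (Ultrafilter.of f : Filter G), s * g ∈ A := fun s =>
    Ultrafilter.of_le f (mem_iInf_of_mem {s} (by simp))
  refine ⟨M * ultrafilterLimit (Ultrafilter.of f), fun s => by rw [← mul_assoc, hM s], ?_⟩
  intro l z hl
  have h : act (ultrafilterLimit (Ultrafilter.of f)) l = z • 1 := by
    ext s
    rw [act_apply]
    change _ = z * 1
    rw [mul_one]
    exact ultrafilterLimit_eq ((hU s).mono fun g hg => hl _ hg)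
  rw [mul_apply, h, map_smul, hM1, smul_eq_mul, mul_one]

/-- Functionals concentrated on disjoint thick sets are separated by the indicator of one of the
sets. -/
theorem IsLeftInvariant.exists_isInvariantDifference_ne_zero [Infinite G] {M : L1Bidual G}
    (hM : IsLeftInvariant M) (hM1 : M 1 = 1) :
    ∃ Γ : L1Bidual G, IsInvariantDifference Γ ∧ Γ ≠ 0 := by
  obtain ⟨A, B, hA, hB, hAB⟩ := exists_disjoint_isThick G
  obtain ⟨N, hN, hNA⟩ := hM.exists_of_isThick hM1 hA
  obtain ⟨N', hN', hNB⟩ := hM.exists_of_isThick hM1 hB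
  refine ⟨N - N', ⟨fun s => by rw [mul_sub, hN s, hN' s], ?_⟩, fun h => ?_⟩
  · change N 1 - N' 1 = 0
    rw [hNA 1 1 fun _ _ => rfl, hNB 1 1 fun _ _ => rfl, sub_self]
  · have h1 : N (LInfty.restrict A 1) - N' (LInfty.restrict A 1) = 0 :=
      DFunLike.congr_fun h (LInfty.restrict A 1)
    rw [hNA _ 1 fun x hx => by rw [LInfty.restrict_apply, if_pos hx]; rfl,
      hNB _ 0 fun x hx => by
        rw [LInfty.restrict_apply, if_neg (Set.disjoint_right.1 hAB hx)]] at h1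
    simp at h1

/-- Left-invariant functionals normalized at `1` pass to subgroups. -/
theorem IsLeftInvariant.exists_subgroup {M : L1Bidual G} (hM : IsLeftInvariant M)
    (hM1 : M 1 = 1) (H : Subgroup G) : ∃ N : L1Bidual H, IsLeftInvariant N ∧ N 1 = 1 := by
  let q : G → Quotient (QuotientGroup.rightRel H) := Quotient.mk _
  have hmem : ∀ x : G, x * (q x).out⁻¹ ∈ H := fun x =>
    QuotientGroup.rightRel_apply.1 (Quotient.mk_out (s := QuotientGroup.rightRel H) x)
  -- Right coset representatives give a left `H`-equivariant map to `H`, along which `M` is pushed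
  -- forward.
  let c : G → H := fun x => ⟨x * (q x).out⁻¹, hmem x⟩
  have hc : ∀ (h : H) (x : G), c (h * x) = h * c x := by
    intro h x
    have hq : q (h * x) = q x := Quotient.sound (QuotientGroup.rightRel_apply.2 (by simp))
    refine Subtype.ext ?_
    change (h : G) * x * (q (h * x)).out⁻¹ = h * (x * (q x).out⁻¹)
    rw [hq, mul_assoc]
  refine ⟨push c M, fun s => ?_, hM1⟩
  ext l
  have h := DFunLike.congr_fun (hM s) (LInfty.pullback c l)
  change _ = M (LInfty.pullback c l)
  rw [← h, pointMass_mul_apply, pointMass_mul_apply]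
  change M _ = M _
  congr 1
  ext x
  change l (s * c x) = l (c (s * x))
  rw [hc]

theorem exists_isInvariantDifferenceOn_ne_zero (hG : IsAmenableGroup G) (H : Subgroup G)
    [Infinite H] : ∃ Γ : L1Bidual H, IsInvariantDifference Γ ∧
      push (fun h : H => (h : G)) Γ ≠ 0 := by
  obtain ⟨M, hM, -, hM1⟩ := hG
  obtain ⟨N, hN, hN1⟩ := hM.exists_subgroup hM1 H
  obtain ⟨Γ, hΓ, hne⟩ := hN.exists_isInvariantDifference_ne_zero hN1
  refine ⟨Γ, hΓ, fun h => hne ?_⟩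
  ext l
  -- Extension by zero shows that restriction to `H` is surjective, so `push` is injective.
  let m : LInfty G := LInfty.ofBounded (Function.extend (fun h : H => (h : G)) (fun h => l h) 0) ‖l‖
    (fun x => by
      by_cases hx : ∃ h : H, (h : G) = x
      · obtain ⟨h, rfl⟩ := hx
        rw [Subtype.val_injective.extend_apply]
        exact LInfty.norm_apply_le l h
      · rw [Function.extend_apply' _ _ _ hx]
        simp)
  have hm : LInfty.pullback (fun h : H => (h : G)) m = l := by
    ext x
    exact Subtype.val_injective.extend_apply _ _ _
  rw [← hm]
  exact DFunLike.congr_fun h m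

/-- Functionals supported on independent subgroups have a non-zero product. -/
theorem IsSupportedOn.mul_ne_zero {A B : Subgroup G} (hAB : Disjoint A B) {Φ Ψ : L1Bidual G}
    (hΦ : Φ.IsSupportedOn A) (hΨ : Ψ.IsSupportedOn B) (hΦ0 : Φ ≠ 0) (hΨ0 : Ψ ≠ 0) :
    Φ * Ψ ≠ 0 := by
  obtain ⟨l, hl⟩ := DFunLike.ne_iff.1 hΦ0
  obtain ⟨m, hm⟩ := DFunLike.ne_iff.1 hΨ0
  let f : A × B → G := fun p => p.1 * p.2
  have hf : Function.Injective f := mul_injective_of_disjoint hAB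
  -- The test function is `l ⊗ m`, carried to `G` by the injective product map; on it `Φ * Ψ` takes
  -- the value `Ψ m * Φ l`.
  let μ : LInfty G := LInfty.ofBounded (Function.extend f (fun p => l p.1 * m p.2) 0) (‖l‖ * ‖m‖)
    (fun x => by
      by_cases hx : ∃ p, f p = x
      · obtain ⟨p, rfl⟩ := hx
        rw [hf.extend_apply, norm_mul]
        exact mul_le_mul (LInfty.norm_apply_le l _) (LInfty.norm_apply_le m _) (norm_nonneg _)
          (norm_nonneg _)
      · rw [Function.extend_apply' _ _ _ hx]
        simpa using mul_nonneg (norm_nonneg l) (norm_nonneg m))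
  have hμ : ∀ a ∈ A, ∀ b ∈ B, μ (a * b) = l a * m b := fun a ha b hb =>
    hf.extend_apply (fun p => l p.1 * m p.2) 0 (⟨a, ha⟩, ⟨b, hb⟩)
  have h : (Φ * Ψ) μ = Ψ m * Φ l := by
    rw [mul_apply, ← smul_eq_mul, ← map_smul]
    refine hΦ.congr fun a ha => ?_
    have h1 : Ψ (LInfty.pullback (fun t => a * t) μ) = Ψ (l a • m) :=
      hΨ.congr fun b hb => hμ a ha b hb
    rw [act_apply, h1, map_smul, smul_eq_mul, mul_comm]
    rfl
  intro h0
  rw [h0] at h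
  exact _root_.mul_ne_zero hm hl h.symm

theorem IsSupportedOn.mul {A B : Subgroup G} {Φ Ψ : L1Bidual G}
    (hΦ : Φ.IsSupportedOn A) (hΨ : Ψ.IsSupportedOn B) :
    (Φ * Ψ).IsSupportedOn (A ⊔ B : Subgroup G) := by
  intro l hl
  refine hΦ _ fun a ha => hΨ _ fun b hb => hl _ ?_
  exact mul_mem (le_sup_left (a := A) ha) (le_sup_right (a := A) hb)

end L1Bidual

/-! ### The lower bound on the index of nilpotency -/

namespace IsHJIDecomposition

open L1Bidual

variable {G : Type*} [Group G] {n : ℕ} {H : Fin n → Subgroup G}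

/-- Multiply one non-zero invariant difference per factor in `s`; tracking the support lets
independence give a non-zero product at each stage. The shift `s.card - 1` appears because
`algebraPowSucc _ k` is the power `k + 1`. -/
theorem exists_mem_algebraPowSucc (hH : IsHJIDecomposition H) (hG : IsAmenableGroup G)
    {s : Finset (Fin n)} (hs : s.Nonempty) :
    ∃ Ψ ∈ algebraPowSucc (Asn G) (s.card - 1),
      Ψ.IsSupportedOn (⨆ i ∈ s, H i : Subgroup G) ∧ Ψ ≠ 0 := by
  classical
  have hfac : ∀ i, ∃ Φ ∈ Asn G, Φ.IsSupportedOn (H i) ∧ Φ ≠ 0 := by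
    intro i
    have := hH.infinite i
    obtain ⟨Γ, hΓ, hne⟩ := exists_isInvariantDifferenceOn_ne_zero hG (H i)
    exact ⟨_, NonUnitalAlgebra.subset_adjoin ℂ ⟨H i, hH.isSubnormal i, Γ, hΓ, rfl⟩,
      hΓ.isInvariantDifferenceOn.supported, hne⟩
  induction hs using Finset.Nonempty.cons_induction with
  | singleton i =>
    obtain ⟨Φ, hΦ, hsup, hne⟩ := hfac i
    exact ⟨Φ, hΦ, by simpa using hsup, hne⟩
  | cons i s hi hs ih =>
    obtain ⟨Φ, hΦ, hΦs, hΦ0⟩ := hfac i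
    obtain ⟨Ψ, hΨ, hΨs, hΨ0⟩ := ih
    have hdis : Disjoint (H i) (⨆ j ∈ s, H j) :=
      (hH.independent i).mono_right (iSup₂_le fun j hj =>
        le_iSup₂_of_le j (by rintro rfl; exact hi hj) le_rfl)
    refine ⟨Φ * Ψ, ?_, ?_, hΦs.mul_ne_zero hdis hΨs hΦ0 hΨ0⟩
    · have hcard : (Finset.cons i s hi).card - 1 = s.card - 1 + 1 := by
        have := hs.card_pos
        rw [Finset.card_cons]
        omega
      rw [hcard]
      exact Submodule.subset_span ⟨Φ, hΦ, Ψ, hΨ, rfl⟩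
    · rw [Finset.cons_eq_insert, Finset.iSup_insert]
      exact hΦs.mul hΨs

theorem algebraPowSucc_ne_bot (hH : IsHJIDecomposition H) (hG : IsAmenableGroup G) {k : ℕ}
    (hk : k < n) : algebraPowSucc (Asn G) k ≠ ⊥ := by
  obtain ⟨s, -, hs⟩ := Finset.exists_subset_card_eq (s := (Finset.univ : Finset (Fin n)))
    (n := k + 1) (by simpa using hk)
  obtain ⟨Ψ, hΨ, -, hne⟩ :=
    hH.exists_mem_algebraPowSucc hG (s := s) (Finset.card_pos.1 (by omega))
  rw [hs, Nat.add_sub_cancel] at hΨ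
  intro h
  rw [h] at hΨ
  exact hne (by simpa using hΨ)

theorem isNilpotentOfIndex (hH : IsHJIDecomposition H) (hG : IsAmenableGroup G) :
    IsNilpotentOfIndex (Asn G) (n + 1) := by
  refine ⟨⟨n, rfl, hH.algebraPowSucc_eq_bot⟩, ?_⟩
  rintro _ ⟨k, rfl, hk⟩
  by_contra hlt
  exact hH.algebraPowSucc_ne_bot hG (by omega) hk

end IsHJIDecomposition

end

theorem proposition4p6 (G : Type*) [Group G] (hamen : IsAmenableGroup G)
    (hji : IsJustInfinite G) (hbaer : baerRadical G = ⊥)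
    (hfin : Finite (StructureLattice G)) :
    (∃ (n : ℕ) (H : Fin n → Subgroup G), IsHJIDecomposition H) ∧
    ∀ (n : ℕ) (H : Fin n → Subgroup G), IsHJIDecomposition H →
      IsNilpotentOfIndex (Asn G) (n + 1) :=
  ⟨exists_isHJIDecomposition hji hbaer, fun _ _ hH => hH.isNilpotentOfIndex hamen⟩
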